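/- Let $n,N\ge 0$ be integers and let $A\in\mathbb H^{N\times N}$, $B\in\mathbb H^{N\times n}$, $C\in\mathbb H^{n\times N}$, $D\in\mathbb H^{n\times n}$ be quaternionic matrices such that the triple $(C,A,B)$ is minimal, that is, $$\bigcap_{t\ge 0}\ker CA^t=\{0\}\quad\text{and}\quad \bigcap_{t\ge 0}\ker B^*A^{*t}=\{0\}.$$ Let $\phi$ be the $\mathbb H^{n\times n}$-valued rational function, slice hyperholomorphic at infinity, with the minimal realization $$\phi(p)=D+C\star(pI_N-A)^{-\star}B,$$ defined for all $p\in\mathbb H$ for which $A^2-2\,\mathrm{Re}(p)A+|p|^2I_N$ is invertible; here $\star$ is the product of (left) slice hyperholomorphic functions, so that $(pI_N-A)^{-\star}=(\overline pI_N-A)(A^2-2\,\mathrm{Re}(p)A+|p|^2I_N)^{-1}$. Let $\mathbb B$ be the open unit ball of $\mathbb H$. Call $\phi$ contractive in $\mathbb B$ (a Schur function) if it extends to a slice hyperholomorphic function $S:\mathbb B\to\mathbb H^{n\times n}$ for which the kernel $$K_S(p,q)=\sum_{u=0}^\infty p^u\,(I_n-S(p)S(q)^*)\,\overline q^{\,u}=(I_n-S(p)S(q)^*)\star(1-p\overline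 q)^{-\star}$$ is positive definite on $\mathbb B$, i.e. for all $r\in\mathbb N$, $u_1,\dots,u_r\in\mathbb B$ and $\xi_1,\dots,\xi_r\in\mathbb H^n$ the $r\times r$ matrix with entries $\xi_k^*K_S(u_k,u_j)\xi_j$ is Hermitian and positive semidefinite. (For matrix-valued functions this is not the same as $\|S(p)\|\le 1$ for every $p\in\mathbb B$.) Then $\phi$ is contractive in $\mathbb B$ if and only if there exists a negative definite (Hermitian) matrix $H\in\mathbb H^{N\times N}$ such that $$\begin{pmatrix}H&0\\0&I_n\end{pmatrix}-\begin{pmatrix}A&B\\C&D\end{pmatrix}^*\begin{pmatrix}H&0\\0&I_n\end{pmatrix}\begin{pmatrix}A&B\\C&D\end{pmatrix}\ge 0 .$$ -/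

import Mathlib

open scoped Quaternion Matrix

noncomputable section

namespace QuatSchur

/-! ### Slice functions -/

/-- The sphere `𝕊` of imaginary units: the quaternions whose square is `-1`. -/
def imagUnits : Set ℍ := {I | I * I = -1}

/-- The imaginary unit `I` with `p = x + I y`, `y = |Im p| ≥ 0`, for a nonreal `p`
(and `0` for a real `p`, where `I` is not determined and the odd part of a slice function is `0`). -/
def sliceUnit (p : ℍ) : ℍ := (‖p.im‖⁻¹ : ℝ) • p.im

/-- A matrix-valued function on an axially symmetric set is (left) slice hyperholomorphic if
`f (x + I y) = α (x, y) + I β (x, y)` with `α` even and `β` odd in `y`, real differentiable and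
satisfying the Cauchy-Riemann equations `∂ₓ α = ∂_y β`, `∂_y α = - ∂ₓ β`
(derivatives are taken entrywise). -/
def SliceHyperholomorphicOn {n m : ℕ} (f : ℍ → Matrix (Fin n) (Fin m) ℍ) (Ω : Set ℍ) : Prop :=
  ∃ α β : ℝ × ℝ → Matrix (Fin n) (Fin m) ℍ,
    (∀ x y : ℝ, α (x, -y) = α (x, y)) ∧
    (∀ x y : ℝ, β (x, -y) = -β (x, y)) ∧
    ∀ (x y : ℝ), ∀ I ∈ imagUnits, (x : ℍ) + I * (y : ℍ) ∈ Ω →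
      f ((x : ℍ) + I * (y : ℍ)) = α (x, y) + I • β (x, y) ∧
      ∀ (i : Fin n) (j : Fin m),
        DifferentiableAt ℝ (fun z => α z i j) (x, y) ∧
        DifferentiableAt ℝ (fun z => β z i j) (x, y) ∧
        fderiv ℝ (fun z => α z i j) (x, y) (1, 0) = fderiv ℝ (fun z => β z i j) (x, y) (0, 1) ∧
        fderiv ℝ (fun z => α z i j) (x, y) (0, 1) = -fderiv ℝ (fun z => β z i j) (x, y) (1, 0)

/-- The component `α` of a slice function `f (x + I y) = α + I β`, at the point `p = x + I y`. -/
def alphaPart {n m : ℕ} (f : ℍ → Matrix (Fin n) (Fin m) ℍ) (p : ℍ) : Matrix (Fin n) (Fin m) ℍ :=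
  (1 / 2 : ℝ) • (f p + f (star p))

/-- The component `β` of a slice function `f (x + I y) = α + I β`, at the point `p = x + I y`,
where `I = sliceUnit p` and `y ≥ 0`. -/
def betaPart {n m : ℕ} (f : ℍ → Matrix (Fin n) (Fin m) ℍ) (p : ℍ) : Matrix (Fin n) (Fin m) ℍ :=
  -(sliceUnit p • ((1 / 2 : ℝ) • (f p - f (star p))))

/-- The star product `(α + I β) ⋆ (γ + I δ) = (α γ - β δ) + I (α δ + β γ)` of slice functions. -/
def starMul {n m k : ℕ} (f : ℍ → Matrix (Fin n) (Fin m) ℍ) (g : ℍ → Matrix (Fin m) (Fin k) ℍ)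
    (p : ℍ) : Matrix (Fin n) (Fin k) ℍ :=
  (alphaPart f p * alphaPart g p - betaPart f p * betaPart g p) +
    sliceUnit p • (alphaPart f p * betaPart g p + betaPart f p * alphaPart g p)

/-! ### Realizations -/

/-- The matrix `A² - 2 Re(p) A + |p|² I`. -/
def charMat {N : ℕ} (A : Matrix (Fin N) (Fin N) ℍ) (p : ℍ) : Matrix (Fin N) (Fin N) ℍ :=
  A * A - (2 * p.re : ℝ) • A + (‖p‖ ^ 2 : ℝ) • (1 : Matrix (Fin N) (Fin N) ℍ)

/-- The set of `p` where `p I - A` has a star inverse (the complement of the S-spectrum of `A`). -/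
def starResolventSet {N : ℕ} (A : Matrix (Fin N) (Fin N) ℍ) : Set ℍ :=
  {p | IsUnit (charMat A p)}

/-- The star inverse `(p I - A)^{-⋆} = (p̄ I - A) (A² - 2 Re(p) A + |p|² I)⁻¹`, for `p` in
`starResolventSet A`; see `starMul_starResolvent` and `starResolvent_starMul`. -/
def starResolvent {N : ℕ} (A : Matrix (Fin N) (Fin N) ℍ) (p : ℍ) : Matrix (Fin N) (Fin N) ℍ :=
  (star p • (1 : Matrix (Fin N) (Fin N) ℍ) - A) * Ring.inverse (charMat A p)

/-- The rational slice hyperholomorphic function `D + C ⋆ (p I - A)^{-⋆} B`, for `p` in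
`starResolventSet A`. -/
def realization {n m N : ℕ} (A : Matrix (Fin N) (Fin N) ℍ) (B : Matrix (Fin N) (Fin m) ℍ)
    (C : Matrix (Fin n) (Fin N) ℍ) (D : Matrix (Fin n) (Fin m) ℍ) (p : ℍ) :
    Matrix (Fin n) (Fin m) ℍ :=
  D + starMul (fun _ => C) (starResolvent A) p * B

/-- The pair `(C, A)` is observable: the kernels of `C Aᵗ`, `t ≥ 0`, intersect in `{0}`. -/
def Observable {n N : ℕ} (C : Matrix (Fin n) (Fin N) ℍ) (A : Matrix (Fin N) (Fin N) ℍ) : Prop :=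
  ⋂ t : ℕ, {x : Fin N → ℍ | (C * A ^ t) *ᵥ x = 0} = {0}

/-- The pair `(A, B)` is controllable: the kernels of `B* A*ᵗ`, `t ≥ 0`, intersect in `{0}`. -/
def Controllable {N m : ℕ} (A : Matrix (Fin N) (Fin N) ℍ) (B : Matrix (Fin N) (Fin m) ℍ) : Prop :=
  ⋂ t : ℕ, {x : Fin N → ℍ | (Bᴴ * Aᴴ ^ t) *ᵥ x = 0} = {0}

/-- The triple `(C, A, B)` is minimal. -/
def Minimal {n N m : ℕ} (C : Matrix (Fin n) (Fin N) ℍ) (A : Matrix (Fin N) (Fin N) ℍ)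
    (B : Matrix (Fin N) (Fin m) ℍ) : Prop :=
  Observable C A ∧ Controllable A B

/-! ### Positivity -/

/-- `M ≥ 0`: the quaternionic matrix `M` is Hermitian and `x* M x ≥ 0` for all vectors `x`
(for Hermitian `M` the quaternion `x* M x` is real). -/
def IsPosSemidef {ι : Type*} [Fintype ι] (M : Matrix ι ι ℍ) : Prop :=
  M.IsHermitian ∧ ∀ x : ι → ℍ, 0 ≤ (star x ⬝ᵥ (M *ᵥ x)).re

/-- `M < 0`: the quaternionic matrix `M` is Hermitian and `x* M x < 0` for all vectors `x ≠ 0`. -/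
def IsNegDef {ι : Type*} [Fintype ι] (M : Matrix ι ι ℍ) : Prop :=
  M.IsHermitian ∧ ∀ x : ι → ℍ, x ≠ 0 → (star x ⬝ᵥ (M *ᵥ x)).re < 0

/-- A matrix-valued kernel is positive definite on `Ω` if all matrices
`(ξ_k* K(u_k, u_j) ξ_j)_{k,j}` with `u_k ∈ Ω` are positive semidefinite. -/
def IsPosDefKernelOn {n : ℕ} (K : ℍ → ℍ → Matrix (Fin n) (Fin n) ℍ) (Ω : Set ℍ) : Prop :=
  ∀ (r : ℕ) (u : Fin r → ℍ) (ξ : Fin r → Fin n → ℍ), (∀ k, u k ∈ Ω) →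
    IsPosSemidef (Matrix.of fun k j => star (ξ k) ⬝ᵥ (K (u k) (u j) *ᵥ ξ j))

/-- The kernel `K_S(p, q) = ∑ᵤ pᵘ (I - S(p) S(q)*) q̄ᵘ`, which is
`(I - S(p) S(q)*) ⋆ (1 - p q̄)^{-⋆}`, for `p`, `q` in the open unit ball. -/
def schurKernel {n m : ℕ} (S : ℍ → Matrix (Fin n) (Fin m) ℍ) (p q : ℍ) :
    Matrix (Fin n) (Fin n) ℍ :=
  Matrix.of fun i j => ∑' u : ℕ, p ^ u * (1 - S p * (S q)ᴴ : Matrix (Fin n) (Fin n) ℍ) i j * star q ^ u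

/-- Contractivity in the open unit ball of a function `f` given on the complement `Ω` of its
singularities: `f` extends to a slice hyperholomorphic function on the ball whose kernel
`K` is positive definite there, in other words `f` is a Schur function. For matrix-valued
slice hyperholomorphic functions this is not the pointwise condition `‖f p‖ ≤ 1`. -/
def IsContractiveInUnitBall {n m : ℕ} (f : ℍ → Matrix (Fin n) (Fin m) ℍ) (Ω : Set ℍ) : Prop :=
  ∃ S : ℍ → Matrix (Fin n) (Fin m) ℍ,
    SliceHyperholomorphicOn S (Metric.ball 0 1) ∧
    Set.EqOn S f (Ω ∩ Metric.ball 0 1) ∧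
    IsPosDefKernelOn (schurKernel S) (Metric.ball 0 1)

/-! ### The definitions of the star inverse and of the kernel make sense -/

theorem norm_im_sq (p : ℍ) : p.re ^ 2 + ‖p.im‖ ^ 2 = ‖p‖ ^ 2 := by
  have h1 := Quaternion.normSq_eq_norm_mul_self p
  have h2 := Quaternion.normSq_eq_norm_mul_self p.im
  rw [Quaternion.normSq_def'] at h1 h2
  simp at h2
  nlinarith

theorem sliceUnit_smul_im (p : ℍ) : sliceUnit p * p.im = (((-‖p.im‖ : ℝ)) : ℍ) := by
  have h2 := Quaternion.normSq_eq_norm_mul_self p.im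
  have h3 : p.im * p.im = -((Quaternion.normSq p.im : ℝ) : ℍ) := by
    rw [← Quaternion.self_mul_star, Quaternion.star_eq_neg.2 (by simp)]; simp
  by_cases h : ‖p.im‖ = 0
  · simp [sliceUnit, h]
  · rw [sliceUnit, smul_mul_assoc, h3, h2, ← Quaternion.coe_neg, ← Quaternion.coe_smul]
    congr 1
    simp only [smul_eq_mul]
    field_simp

theorem re_sub_im (p : ℍ) : star p = (p.re : ℍ) - p.im := by
  ext <;> simp

theorem smul_coe_mat {n m : ℕ} (r : ℝ) (M : Matrix (Fin n) (Fin m) ℍ) :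
    ((r : ℝ) : ℍ) • M = r • M := by
  refine Matrix.ext fun i j => ?_
  rw [Matrix.smul_apply, Matrix.smul_apply, smul_eq_mul, Quaternion.coe_mul_eq_smul]

theorem charMat_star {N : ℕ} (A : Matrix (Fin N) (Fin N) ℍ) (p : ℍ) :
    charMat A (star p) = charMat A p := by
  simp [charMat]

theorem starResolvent_parts {N : ℕ} (A : Matrix (Fin N) (Fin N) ℍ) (p : ℍ) :
    alphaPart (starResolvent A) p = (p.re • 1 - A) * Ring.inverse (charMat A p) ∧
    betaPart (starResolvent A) p = -(‖p.im‖ • Ring.inverse (charMat A p)) := by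
  constructor
  · have : (1 / 2 : ℝ) • ((star p • (1 : Matrix (Fin N) (Fin N) ℍ) - A) + (p • 1 - A))
        = p.re • 1 - A := by
      have h : star p + p = ((2 * p.re : ℝ) : ℍ) := by
        rw [add_comm, Quaternion.self_add_star']
      rw [show (star p • (1 : Matrix (Fin N) (Fin N) ℍ) - A) + (p • 1 - A)
        = (star p + p) • 1 - (2 : ℝ) • A by rw [add_smul, two_smul]; abel, h, smul_coe_mat,
        smul_sub, smul_smul, smul_smul, show (1 / 2 : ℝ) * (2 * p.re) = p.re by ring]
      norm_num
    rw [alphaPart, starResolvent, starResolvent, charMat_star, star_star, ← add_mul,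
      ← smul_mul_assoc, this]
  · have : sliceUnit p • ((1 / 2 : ℝ) • ((star p • (1 : Matrix (Fin N) (Fin N) ℍ) - A)
        - (p • 1 - A))) = ‖p.im‖ • 1 := by
      have h : star p - p = (-2 : ℝ) • p.im := by
        ext <;> simp <;> ring
      rw [sub_sub_sub_cancel_right, ← sub_smul, h, smul_assoc, smul_smul]
      norm_num
      rw [smul_smul, sliceUnit_smul_im, smul_coe_mat]
      simp
    rw [betaPart, starResolvent, starResolvent, charMat_star, star_star, ← sub_mul,
      ← smul_mul_assoc, ← smul_mul_assoc, this, smul_mul_assoc, one_mul]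

theorem linear_parts {N : ℕ} (A : Matrix (Fin N) (Fin N) ℍ) (p : ℍ) :
    alphaPart (fun q => q • (1 : Matrix (Fin N) (Fin N) ℍ) - A) p = p.re • 1 - A ∧
    betaPart (fun q => q • (1 : Matrix (Fin N) (Fin N) ℍ) - A) p = ‖p.im‖ • 1 := by
  constructor
  · have h : p + star p = ((2 * p.re : ℝ) : ℍ) := by
      rw [Quaternion.self_add_star']
    rw [alphaPart, show (p • (1 : Matrix (Fin N) (Fin N) ℍ) - A) + (star p • 1 - A)
        = (p + star p) • 1 - (2 : ℝ) • A by rw [add_smul, two_smul]; abel, h, smul_coe_mat,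
        smul_sub, smul_smul, smul_smul, show (1 / 2 : ℝ) * (2 * p.re) = p.re by ring]
    norm_num
  · have h : p - star p = (2 : ℝ) • p.im := by
      ext <;> simp <;> ring
    rw [betaPart, sub_sub_sub_cancel_right, ← sub_smul, h, smul_assoc, smul_smul]
    norm_num
    rw [smul_smul, sliceUnit_smul_im, smul_coe_mat]
    simp

theorem charMat_eq {N : ℕ} (A : Matrix (Fin N) (Fin N) ℍ) (p : ℍ) :
    charMat A p = (p.re • 1 - A) * (p.re • 1 - A) + (‖p.im‖ ^ 2) • 1 := by
  rw [charMat, ← norm_im_sq p]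
  simp only [sub_mul, mul_sub, smul_mul_assoc, mul_smul_comm, one_mul, mul_one, smul_sub,
    smul_smul, add_smul, two_mul, pow_two]
  abel

/-- `(p I - A) ⋆ (p I - A)^{-⋆} = I`. -/
theorem starMul_starResolvent {N : ℕ} (A : Matrix (Fin N) (Fin N) ℍ) {p : ℍ}
    (hp : p ∈ starResolventSet A) :
    starMul (fun q => q • (1 : Matrix (Fin N) (Fin N) ℍ) - A) (starResolvent A) p = 1 := by
  have h := Ring.mul_inverse_cancel (charMat A p) hp
  rw [starMul, (linear_parts A p).1, (linear_parts A p).2, (starResolvent_parts A p).1,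
    (starResolvent_parts A p).2]
  nth_rewrite 1 [charMat_eq] at h
  simp only [add_mul, smul_mul_assoc, one_mul, mul_neg, mul_smul_comm, neg_add_cancel, smul_zero,
    add_zero, sub_neg_eq_add, smul_smul, ← pow_two, ← mul_assoc] at h ⊢
  exact h

/-- `(p I - A)^{-⋆} ⋆ (p I - A) = I`. -/
theorem starResolvent_starMul {N : ℕ} (A : Matrix (Fin N) (Fin N) ℍ) {p : ℍ}
    (hp : p ∈ starResolventSet A) :
    starMul (starResolvent A) (fun q => q • (1 : Matrix (Fin N) (Fin N) ℍ) - A) p = 1 := by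
  have h := Ring.inverse_mul_cancel (charMat A p) hp
  have hc : Commute (p.re • (1 : Matrix (Fin N) (Fin N) ℍ) - A) (charMat A p) := by
    rw [charMat_eq]
    refine Commute.add_right ((Commute.refl _).mul_right (Commute.refl _)) ?_
    exact (Commute.one_right _).smul_right _
  have hc' : (p.re • (1 : Matrix (Fin N) (Fin N) ℍ) - A) * Ring.inverse (charMat A p)
      = Ring.inverse (charMat A p) * (p.re • (1 : Matrix (Fin N) (Fin N) ℍ) - A) :=
    (Ring.inverse_mul_eq_iff_eq_mul _ _ _ hp).2 (by
      rw [← mul_assoc, ← hc.eq, mul_assoc, Ring.mul_inverse_cancel _ hp, mul_one]) |>.symm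
  rw [starMul, (linear_parts A p).1, (linear_parts A p).2, (starResolvent_parts A p).1,
    (starResolvent_parts A p).2, hc']
  nth_rewrite 2 [charMat_eq] at h
  simp only [mul_add, neg_mul, smul_mul_assoc, mul_one, mul_smul_comm, add_neg_cancel,
    smul_zero, add_zero, smul_neg, sub_neg_eq_add, smul_smul, ← pow_two, mul_assoc] at h ⊢
  exact h

/-- The series that defines the kernel converges for `p`, `q` in the open unit ball. -/
theorem summable_schurKernel (c : ℍ) {p q : ℍ} (hp : p ∈ Metric.ball (0 : ℍ) 1)
    (hq : q ∈ Metric.ball (0 : ℍ) 1) : Summable fun u : ℕ => p ^ u * c * star q ^ u := by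
  rw [mem_ball_zero_iff] at hp hq
  have h : ‖p‖ * ‖q‖ < 1 := by nlinarith [norm_nonneg p, norm_nonneg q]
  refine Summable.of_norm_bounded
    ((summable_geometric_of_lt_one (by positivity) h).mul_left ‖c‖) fun u => ?_
  rw [norm_mul, norm_mul, norm_pow, norm_pow, norm_star, mul_pow]
  exact le_of_eq (by ring)

end QuatSchur

end

/-!
A minimal realization `D + C ⋆ (p I - A)^{-⋆} B` is a Schur function if and only if the linear
system `x ↦ A x + B u`, with output `C x + D u`, admits a positive definite storage function
`K = -H` with
`x* K x + |C x + D u|² ≤ (A x + B u)* K (A x + B u) + |u|²`,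
which is the matrix inequality of the theorem written out on vectors
(`isPosSemidef_fromBlocks_iff`).

*From the kernel to the matrix.* Only the values of the kernel at real points are needed; there
`K_S(x, y)` is `(1 - x y)⁻¹ (I - S(x) S(y)*)`. It bounds `S` near `0`, and together with
minimality this forces `A` to be invertible (`isUnit_of_contractive`). Then the realization has a
Taylor expansion at `0`, and testing the kernel at the points of a Vandermonde system that shrinks
to `0` shows that the Toeplitz matrices of the Taylor coefficients are contractions
(`sum_toeplitz_conjTranspose_le`, `sum_toeplitz_le`). Run backwards in time, trajectories of the
system that end in the state `0` are described by these Toeplitz matrices, so the inputs carry at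
least as much energy as the outputs (`supply_nonneg`). The storage function is the infimum of
`∑ |u_k|² - |y_k|²` over the trajectories that lead from a given state to `0`. It satisfies the
dissipation inequality because a trajectory can be prolonged by one step at its beginning. It
satisfies the parallelogram law and is homogeneous under right multiplication by quaternions, hence
is the quadratic form of a Hermitian matrix (`exists_isHermitian_of_parallelogram`), and it is
definite by observability (`exists_isNegDef_of_contractive`).

*From the matrix to the kernel.* The inequality makes `A² - 2 Re(p) A + |p|²` invertible in the unit
ball (`isUnit_charMat_of_norm_lt_one`), so that the realization is slice hyperholomorphic there
(`sliceHyperholomorphicOn_realization`). By Cauchy-Schwarz the dual system satisfies the dissipation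
inequality with `K⁻¹` in the place of `K` (`dual_dissipation`). For `g = C ⋆ (p I - A)^{-⋆}` one has
`p g = g A + C` and `S = D + g B`, with pointwise products, so the dual inequality
telescopes along the series that defines the kernel (`isPosDefKernelOn_realization`).
-/

open scoped Quaternion Matrix

noncomputable section

namespace QuatSchur

/-! ### Quaternionic vectors as real vector spaces -/

section LinearAlgebra

variable {ι κ : Type*} [Fintype ι]

/-- The real inner product `Re (x* y)` on quaternionic vectors, as a real bilinear map. -/
def reInner : (ι → ℍ) →ₗ[ℝ] (ι → ℍ) →ₗ[ℝ] ℝ :=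
  LinearMap.mk₂ ℝ (fun x y => (star x ⬝ᵥ y).re)
    (fun x y z => by simp [add_dotProduct])
    (fun c x y => by
      rw [show star (c • x) = c • star x from funext fun i => Quaternion.star_smul c (x i),
        smul_dotProduct, Quaternion.re_smul,
        smul_eq_mul])
    (fun x y z => by simp [dotProduct_add])
    (fun c x y => by simp only [dotProduct_smul, Quaternion.re_smul, smul_eq_mul])

theorem reInner_apply (x y : ι → ℍ) : reInner x y = (star x ⬝ᵥ y).re := rfl

theorem reInner_comm (x y : ι → ℍ) : reInner x y = reInner y x := by
  rw [reInner_apply, reInner_apply, ← Quaternion.re_star, ← Matrix.star_dotProduct]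

theorem re_sum {α : Type*} (s : Finset α) (f : α → ℍ) : (∑ i ∈ s, f i).re = ∑ i ∈ s, (f i).re :=
  map_sum (⟨⟨fun a : ℍ => a.re, rfl⟩, fun _ _ => rfl⟩ : ℍ →+ ℝ) f s

theorem reInner_self (x : ι → ℍ) : reInner x x = ∑ i, ‖x i‖ ^ 2 := by
  rw [reInner_apply, dotProduct, re_sum]
  refine Finset.sum_congr rfl fun i _ => ?_
  rw [Pi.star_apply, Quaternion.star_mul_self, Quaternion.re_coe,
    Quaternion.normSq_eq_norm_mul_self, pow_two]

theorem reInner_self_nonneg (x : ι → ℍ) : 0 ≤ reInner x x := by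
  rw [reInner_self]; positivity

theorem reInner_self_eq_zero {x : ι → ℍ} : reInner x x = 0 ↔ x = 0 := by
  rw [reInner_self, Finset.sum_eq_zero_iff_of_nonneg fun i _ => by positivity, funext_iff]
  simp

theorem two_mul_reInner_le (x y : ι → ℍ) : 2 * reInner x y ≤ reInner x x + reInner y y := by
  have h := reInner_self_nonneg (x - y)
  simp only [map_sub, LinearMap.sub_apply, reInner_comm y x] at h
  linarith

theorem reInner_mulVec [Fintype κ] (M : Matrix ι κ ℍ) (x : ι → ℍ) (y : κ → ℍ) :
    reInner x (M *ᵥ y) = reInner (Mᴴ *ᵥ x) y := by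
  rw [reInner_apply, reInner_apply, Matrix.star_mulVec, Matrix.conjTranspose_conjTranspose,
    Matrix.dotProduct_mulVec]

theorem op_coe_smul {ι : Type*} (r : ℝ) (x : ι → ℍ) : MulOpposite.op (r : ℍ) • x = r • x := by
  funext i
  rw [Pi.smul_apply, Pi.smul_apply, MulOpposite.smul_eq_mul_unop, MulOpposite.unop_op,
    Quaternion.mul_coe_eq_smul]

theorem mulVec_op_smul (M : Matrix κ ι ℍ) (c : ℍ) (x : ι → ℍ) :
    M *ᵥ (MulOpposite.op c • x) = MulOpposite.op c • (M *ᵥ x) :=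
  Matrix.mulVec_smul M _ x

theorem reInner_op_smul (c : ℍ) (x y : ι → ℍ) :
    reInner (MulOpposite.op c • x) (MulOpposite.op c • y) = ‖c‖ ^ 2 * reInner x y := by
  simp only [reInner_apply, dotProduct, re_sum, Finset.mul_sum]
  refine Finset.sum_congr rfl fun i _ => ?_
  have h : (star c * (star (x i) * y i * c)).re = ((star (x i) * y i * c) * star c).re := by
    simp only [Quaternion.re_mul]; ring
  simp only [Pi.star_apply, Pi.smul_apply, MulOpposite.smul_eq_mul_unop, MulOpposite.unop_op,
    star_mul]
  rw [mul_assoc, ← mul_assoc (star (x i)), h, mul_assoc, Quaternion.self_mul_star,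
    Quaternion.normSq_eq_norm_mul_self, Quaternion.mul_coe_eq_smul, Quaternion.re_smul,
    smul_eq_mul, pow_two]

/-- Multiplication of quaternionic vectors by a matrix, as a real linear map. -/
def mulVecReal (M : Matrix κ ι ℍ) : (ι → ℍ) →ₗ[ℝ] (κ → ℍ) where
  toFun x := M *ᵥ x
  map_add' := Matrix.mulVec_add M
  map_smul' c x := Matrix.mulVec_smul M c x

theorem mulVecReal_apply (M : Matrix κ ι ℍ) (x : ι → ℍ) : mulVecReal M x = M *ᵥ x := rfl

/-- A quaternionic matrix with trivial kernel is invertible: left multiplication by it is an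
injective real endomorphism of the finite dimensional matrix algebra. -/
theorem isUnit_of_ker_eq_bot [DecidableEq ι] {M : Matrix ι ι ℍ} (h : ∀ x, M *ᵥ x = 0 → x = 0) :
    IsUnit M := by
  have hX : ∀ X : Matrix ι ι ℍ, M * X = 0 → X = 0 := fun X hX => by
    refine Matrix.ext fun i j => ?_
    refine congrFun (h (fun i => X i j) (funext fun k => ?_)) i
    exact congrFun (congrFun hX k) j
  have hinj : Function.Injective (LinearMap.mulLeft ℝ M) :=
    (injective_iff_map_eq_zero _).2 fun X => hX X
  obtain ⟨Y, hY⟩ := LinearMap.surjective_of_injective hinj 1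
  rw [LinearMap.mulLeft_apply] at hY
  refine ⟨⟨M, Y, hY, ?_⟩, rfl⟩
  rw [← sub_eq_zero]
  apply hX
  rw [mul_sub, ← mul_assoc, hY, one_mul, mul_one, sub_self]

/-- A controllable pair has full reachable space: a functional that vanishes on the reachable space
is an inner product with some `w`, and testing it on `Aᵏ B (B* A*ᵏ w)` gives `B* A*ᵏ w = 0`. -/
theorem span_range_pow_mul_mulVec [Fintype κ] [DecidableEq ι] (A : Matrix ι ι ℍ) (B : Matrix ι κ ℍ)
    (h : ∀ w, (∀ k : ℕ, (Bᴴ * Aᴴ ^ k) *ᵥ w = 0) → w = 0) :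
    Submodule.span ℝ {x | ∃ (k : ℕ) (u : κ → ℍ), x = (A ^ k * B) *ᵥ u} = ⊤ := by
  by_contra hne
  obtain ⟨f, hf0, hf⟩ := Submodule.exists_le_ker_of_lt_top _ (lt_top_iff_ne_top.2 hne)
  have hinj : Function.Injective (reInner : (ι → ℍ) →ₗ[ℝ] (ι → ℍ) →ₗ[ℝ] ℝ) :=
    (injective_iff_map_eq_zero _).2 fun w hw => by
      rw [← reInner_self_eq_zero, hw]; rfl
  obtain ⟨w, rfl⟩ := (LinearMap.injective_iff_surjective_of_finrank_eq_finrank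
    (Subspace.dual_finrank_eq (K := ℝ) (V := ι → ℍ)).symm).1 hinj f
  have hw : w = 0 := h w fun k => by
    have h1 := hf (Submodule.subset_span ⟨k, (Bᴴ * Aᴴ ^ k) *ᵥ w, rfl⟩)
    rw [LinearMap.mem_ker, reInner_mulVec, Matrix.conjTranspose_mul,
      Matrix.conjTranspose_pow] at h1
    exact reInner_self_eq_zero.1 h1
  exact hf0 (by rw [hw, map_zero])

/-- For an invertible `A`, an observable pair `(C, A)` is also observable along the powers of
`A⁻¹`: the corresponding unobservable space is mapped injectively into itself, hence onto itself,
by `A⁻¹`, so it is invariant under `A`. -/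
theorem eq_zero_of_inverse_observable [DecidableEq ι] {A A' : Matrix ι ι ℍ} {C : Matrix κ ι ℍ}
    (h : ∀ x, (∀ k : ℕ, (C * A ^ k) *ᵥ x = 0) → x = 0) (hA : A * A' = 1) (hA' : A' * A = 1)
    {x : ι → ℍ} (hx : ∀ k : ℕ, (C * A' ^ (k + 1)) *ᵥ x = 0) : x = 0 := by
  let U : Submodule ℝ (ι → ℍ) := ⨅ k : ℕ, LinearMap.ker (mulVecReal (C * A' ^ (k + 1)))
  have hU : ∀ y, y ∈ U ↔ ∀ k : ℕ, (C * A' ^ (k + 1)) *ᵥ y = 0 := fun y => by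
    simp only [U, Submodule.mem_iInf, LinearMap.mem_ker, mulVecReal_apply]
  have hmaps : ∀ y ∈ U, mulVecReal A' y ∈ U := fun y hy => (hU _).2 fun k => by
    rw [mulVecReal_apply, Matrix.mulVec_mulVec, Matrix.mul_assoc, ← pow_succ]
    exact (hU y).1 hy (k + 1)
  have hinj : Function.Injective ((mulVecReal A').restrict hmaps) := by
    intro y z hyz
    have h1 : A' *ᵥ y.1 = A' *ᵥ z.1 := congrArg Subtype.val hyz
    have h2 := congrArg (A *ᵥ ·) h1
    simp only [Matrix.mulVec_mulVec, hA, Matrix.one_mulVec] at h2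
    exact Subtype.ext h2
  have hA_maps : ∀ y ∈ U, A *ᵥ y ∈ U := fun y hy => by
    obtain ⟨z, hz⟩ := LinearMap.surjective_of_injective hinj ⟨y, hy⟩
    have h1 : A' *ᵥ z.1 = y := congrArg Subtype.val hz
    rw [← h1, Matrix.mulVec_mulVec, hA, Matrix.one_mulVec]
    exact z.2
  have hpow : ∀ k : ℕ, (A ^ k) *ᵥ x ∈ U := fun k => by
    induction k with
    | zero => rw [pow_zero, Matrix.one_mulVec]; exact (hU x).2 hx
    | succ k ih => rw [pow_succ', ← Matrix.mulVec_mulVec]; exact hA_maps _ ih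
  refine h x fun k => ?_
  have h1 := (hU _).1 (hpow (k + 1)) 0
  rwa [Matrix.mulVec_mulVec, zero_add, pow_one, pow_succ', Matrix.mul_assoc, ← Matrix.mul_assoc A', hA',
    Matrix.one_mul] at h1

end LinearAlgebra

/-! ### Hermitian matrices from quadratic functionals -/

section JordanVonNeumann

/-- The polarization of a function that satisfies the parallelogram law. -/
def polarForm {E : Type*} [AddCommGroup E] (q : E → ℝ) (x y : E) : ℝ := (q (x + y) - q (x - y)) / 4

/-- The Jordan-von Neumann theorem for a nonnegative function `q` with real homogeneity. -/
theorem polarForm_linear {E : Type*} [AddCommGroup E] [Module ℝ E] {q : E → ℝ}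
    (h0 : ∀ x, 0 ≤ q x) (hp : ∀ x y, q (x + y) + q (x - y) = 2 * q x + 2 * q y)
    (hs : ∀ (r : ℝ) x, q (r • x) = r ^ 2 * q x) :
    (∀ x y z, polarForm q (x + y) z = polarForm q x z + polarForm q y z) ∧
    (∀ (r : ℝ) x y, polarForm q (r • x) y = r * polarForm q x y) := by
  have hneg : ∀ x, q (-x) = q x := fun x => by
    have := hs (-1) x
    rw [neg_one_smul] at this
    linarith
  have hz : ∀ y, polarForm q 0 y = 0 := fun y => by simp [polarForm, hneg]
  have hmid : ∀ x y z, polarForm q (x + z) y + polarForm q (x - z) y = 2 * polarForm q x y := by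
    intro x y z
    have h1 := hp (x + y) z
    have h2 := hp (x - y) z
    simp only [polarForm]
    rw [show x + z + y = x + y + z by abel, show x + z - y = x - y + z by abel,
      show x - z + y = x + y - z by abel, show x - z - y = x - y - z by abel]
    linarith
  have htwo : ∀ x y, polarForm q ((2 : ℝ) • x) y = 2 * polarForm q x y := fun x y => by
    have := hmid x y x
    rw [sub_self, hz, ← two_smul ℝ x] at this
    linarith
  have hadd : ∀ x y z, polarForm q (x + y) z = polarForm q x z + polarForm q y z := by
    intro x y z
    have h1 := hmid ((1 / 2 : ℝ) • (x + y)) z ((1 / 2 : ℝ) • (x - y))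
    rw [← smul_add, ← smul_sub, show x + y + (x - y) = (2 : ℝ) • x by rw [two_smul]; abel,
      show x + y - (x - y) = (2 : ℝ) • y by rw [two_smul]; abel, smul_smul, smul_smul,
      show (1 / 2 : ℝ) * 2 = 1 by norm_num, one_smul, one_smul, ← htwo, smul_smul,
      show (2 : ℝ) * (1 / 2) = 1 by norm_num, one_smul] at h1
    exact h1.symm
  refine ⟨hadd, fun r x y => ?_⟩
  -- The additive function `f` is periodic, hence bounded, hence zero.
  let f : ℝ →+ ℝ :=
    { toFun := fun t => polarForm q (t • x) y - t * polarForm q x y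
      map_zero' := by simp [hz]
      map_add' := fun s t => by rw [add_smul, hadd]; ring }
  have hf : ∀ t, f t = polarForm q (t • x) y - t * polarForm q x y := fun t => rfl
  have hint : ∀ t : ℝ, f t = f (Int.fract t) := fun t => by
    have h1 : f 1 = 0 := by rw [hf, one_smul, one_mul, sub_self]
    have h2 : f ((⌊t⌋ : ℤ) : ℝ) = 0 := by
      rw [show ((⌊t⌋ : ℤ) : ℝ) = ⌊t⌋ • (1 : ℝ) by simp, map_zsmul, h1, smul_zero]
    nth_rewrite 1 [← Int.floor_add_fract t]
    rw [map_add, h2, zero_add]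
  have hbd : ∀ t : ℝ, |f t| ≤ (q x + q y) / 2 + |polarForm q x y| := fun t => by
    have h1 := Int.fract_nonneg t
    have h2 := (Int.fract_lt_one t).le
    have h3 : |polarForm q (Int.fract t • x) y| ≤ (q x + q y) / 2 := by
      have h4 := hp (Int.fract t • x) y
      have h5 := h0 (Int.fract t • x + y)
      have h6 := h0 (Int.fract t • x - y)
      have h7 : q (Int.fract t • x) ≤ q x := by
        rw [hs]
        exact mul_le_of_le_one_left (h0 x) (pow_le_one₀ h1 h2)
      rw [polarForm, abs_le]
      constructor <;> linarith
    rw [hint, hf]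
    refine (abs_sub _ _).trans (add_le_add h3 ?_)
    rw [abs_mul, abs_of_nonneg h1]
    exact mul_le_of_le_one_left (abs_nonneg _) h2
  have hfr : f r = 0 := by
    by_contra hne
    obtain ⟨k, hk⟩ := exists_nat_gt (((q x + q y) / 2 + |polarForm q x y|) / |f r|)
    rw [div_lt_iff₀ (abs_pos.2 hne)] at hk
    have h1 := hbd (k • r)
    rw [map_nsmul, nsmul_eq_mul, abs_mul, Nat.abs_cast] at h1
    linarith
  rw [hf] at hfr
  linarith

variable {ι : Type*} [Fintype ι] [DecidableEq ι]

theorem ext_re_mul {a b : ℍ} (h : ∀ c : ℍ, (a * c).re = (b * c).re) : a = b := by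
  have h1 := h (star (a - b))
  rw [← sub_eq_zero, ← Quaternion.re_sub, ← sub_mul, Quaternion.self_mul_star,
    Quaternion.re_coe, Quaternion.normSq_eq_zero] at h1
  exact sub_eq_zero.1 h1

/-- Every real functional on the quaternions has the form `c ↦ Re (a c)`. -/
theorem exists_re_mul_eq (f : ℍ →ₗ[ℝ] ℝ) : ∃ a : ℍ, ∀ c, (a * c).re = f c := by
  let L : ℍ →ₗ[ℝ] ℍ →ₗ[ℝ] ℝ := LinearMap.mk₂ ℝ (fun a c => (a * c).re)
    (fun a b c => by rw [add_mul, Quaternion.re_add])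
    (fun r a c => by rw [smul_mul_assoc, Quaternion.re_smul])
    (fun a b c => by rw [mul_add, Quaternion.re_add])
    (fun r a c => by rw [mul_smul_comm, Quaternion.re_smul])
  have hinj : Function.Injective L := fun a b hab =>
    ext_re_mul fun c => congrFun (congrArg DFunLike.coe hab) c
  obtain ⟨a, ha⟩ := (LinearMap.injective_iff_surjective_of_finrank_eq_finrank
    (Subspace.dual_finrank_eq (K := ℝ) (V := ℍ)).symm).1 hinj f
  exact ⟨a, fun c => congrFun (congrArg DFunLike.coe ha) c⟩

/-- A nonnegative function on quaternionic vectors that satisfies one half of the parallelogram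
law and of homogeneity under right multiplication by quaternions is the quadratic form of a
Hermitian matrix. -/
theorem exists_isHermitian_of_parallelogram {q : (ι → ℍ) → ℝ} (h0 : ∀ x, 0 ≤ q x)
    (hp' : ∀ x y, q (x + y) + q (x - y) ≤ 2 * q x + 2 * q y)
    (hs' : ∀ (c : ℍ) x, q (MulOpposite.op c • x) ≤ ‖c‖ ^ 2 * q x) :
    ∃ H : Matrix ι ι ℍ, H.IsHermitian ∧ ∀ x, (star x ⬝ᵥ (H *ᵥ x)).re = q x := by
  have hs : ∀ (c : ℍ) x, q (MulOpposite.op c • x) = ‖c‖ ^ 2 * q x := fun c x => by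
    refine le_antisymm (hs' c x) ?_
    by_cases hc : c = 0
    · rw [hc]; simpa using h0 0
    · have h1 := hs' c⁻¹ (MulOpposite.op c • x)
      rw [smul_smul, ← MulOpposite.op_mul, mul_inv_cancel₀ hc, MulOpposite.op_one, one_smul,
        norm_inv, inv_pow] at h1
      have h2 : 0 < ‖c‖ ^ 2 := by positivity
      rwa [← le_inv_mul_iff₀ h2]
  have hsr : ∀ (r : ℝ) x, q (r • x) = r ^ 2 * q x := fun r x => by
    rw [← op_coe_smul, hs, Quaternion.norm_coe, Real.norm_eq_abs, sq_abs]
  have hp : ∀ x y, q (x + y) + q (x - y) = 2 * q x + 2 * q y := fun x y => by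
    refine le_antisymm (hp' x y) ?_
    have h1 := hp' (x + y) (x - y)
    rw [show x + y + (x - y) = (2 : ℝ) • x by rw [two_smul]; abel,
      show x + y - (x - y) = (2 : ℝ) • y by rw [two_smul]; abel, hsr, hsr] at h1
    linarith
  obtain ⟨hadd, hsmul⟩ := polarForm_linear h0 hp hsr
  have hcomm : ∀ x y, polarForm q x y = polarForm q y x := fun x y => by
    have h1 := hsr (-1) (x - y)
    rw [neg_one_smul, neg_sub] at h1
    rw [polarForm, polarForm, add_comm y x, h1]
    ring
  let P : (ι → ℍ) →ₗ[ℝ] (ι → ℍ) →ₗ[ℝ] ℝ := LinearMap.mk₂ ℝ (polarForm q) hadd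
    (fun r x y => by rw [hsmul, smul_eq_mul])
    (fun x y z => by rw [hcomm, hadd, hcomm y, hcomm z])
    (fun r x y => by rw [hcomm, hsmul, hcomm y, smul_eq_mul])
  have hPc : ∀ x y, P x y = P y x := hcomm
  have hPq : ∀ x, P x x = q x := fun x => by
    have h1 := hsr 0 x
    rw [zero_smul] at h1
    change (q (x + x) - q (x - x)) / 4 = q x
    rw [sub_self, h1, ← two_smul ℝ x, hsr]
    ring
  have hPs : ∀ (c : ℍ) x y,
      P (MulOpposite.op c • x) (MulOpposite.op c • y) = ‖c‖ ^ 2 * P x y := fun c x y => by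
    change (q _ - q _) / 4 = ‖c‖ ^ 2 * ((q _ - q _) / 4)
    rw [← smul_add, ← smul_sub, hs, hs]
    ring
  have hPadj : ∀ (c : ℍ) x y,
      P (MulOpposite.op c • x) y = P x (MulOpposite.op (star c) • y) := fun c x y => by
    by_cases hc : c = 0
    · simp [hc]
    · have h1 : y = MulOpposite.op c • (MulOpposite.op c⁻¹ • y) := by
        rw [smul_smul, ← MulOpposite.op_mul, inv_mul_cancel₀ hc, MulOpposite.op_one, one_smul]
      have h2 : star c = (‖c‖ ^ 2 : ℝ) • c⁻¹ := by
        rw [Quaternion.inv_def, smul_smul, Quaternion.normSq_eq_norm_mul_self, ← pow_two,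
          mul_inv_cancel₀ (by positivity), one_smul]
      rw [h2]
      nth_rewrite 1 [h1]
      rw [hPs, MulOpposite.op_smul, smul_assoc, (P x).map_smul, smul_eq_mul]
  -- `c ↦ P (e_a) (e_b c)` a real functional of `c`; the entry of the matrix represents it.
  let e : ι → ℍ → ι → ℍ := fun a c => Pi.single a c
  have he : ∀ a c d, e a (c * d) = MulOpposite.op d • e a c := fun a c d => by
    funext i
    by_cases hi : i = a
    · subst hi; simp [e]
    · simp [e, hi]
  have hrep : ∀ a b, ∃ z : ℍ, ∀ c, (z * c).re = P (e a 1) (e b c) := fun a b =>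
    exists_re_mul_eq (P (e a 1) ∘ₗ LinearMap.single ℝ (fun _ => ℍ) b)
  choose h hh using hrep
  let H : Matrix ι ι ℍ := Matrix.of h
  have hH : ∀ a b c, (H a b * c).re = P (e a 1) (e b c) := hh
  have hH2 : ∀ a b c d, (star c * H a b * d).re = P (e a c) (e b d) := fun a b c d => by
    have h1 : (star c * H a b * d).re = (H a b * (d * star c)).re := by
      rw [mul_assoc, ← mul_assoc (H a b)]
      simp only [Quaternion.re_mul]
      ring
    rw [h1, hH, he, ← hPadj, ← he, one_mul]
  refine ⟨H, ?_, fun x => ?_⟩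
  · refine Matrix.IsHermitian.ext fun a b => ext_re_mul fun c => ?_
    have h1 : (star (H b a) * c).re = (star c * H b a * 1).re := by
      rw [← Quaternion.re_star, star_mul, star_star, mul_one]
    rw [h1, hH2, hH, hPc]
  · have hx : x = ∑ a, e a (x a) := (Finset.univ_sum_single x).symm
    rw [← hPq]
    conv_rhs => rw [hx]
    simp only [map_sum, LinearMap.sum_apply, dotProduct, Matrix.mulVec, re_sum, Finset.mul_sum,
      Pi.star_apply]
    rw [Finset.sum_comm]
    refine Finset.sum_congr rfl fun b _ => Finset.sum_congr rfl fun a _ => ?_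
    rw [← mul_assoc, hH2]

end JordanVonNeumann

/-! ### The storage function -/

section Storage

variable {N n : ℕ} {A : Matrix (Fin N) (Fin N) ℍ} {B : Matrix (Fin N) (Fin n) ℍ}
  {C : Matrix (Fin n) (Fin N) ℍ} {D : Matrix (Fin n) (Fin n) ℍ}

/-- The trajectory of `x ↦ A x + B u` with a given initial state and inputs `u 0, u 1, …`. -/
def stateSeq (A : Matrix (Fin N) (Fin N) ℍ) (B : Matrix (Fin N) (Fin n) ℍ) (x : Fin N → ℍ)
    (u : ℕ → Fin n → ℍ) : ℕ → Fin N → ℍ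
  | 0 => x
  | k + 1 => A *ᵥ stateSeq A B x u k + B *ᵥ u k

/-- The inputs `u` vanish from time `m` on and steer the state `x` to `0` at time `m`. -/
def Steers (A : Matrix (Fin N) (Fin N) ℍ) (B : Matrix (Fin N) (Fin n) ℍ) (x : Fin N → ℍ)
    (u : ℕ → Fin n → ℍ) (m : ℕ) : Prop :=
  (∀ k, m ≤ k → u k = 0) ∧ stateSeq A B x u m = 0

/-- The output `C x + D u` at time `k`. -/
def outputSeq (A : Matrix (Fin N) (Fin N) ℍ) (B : Matrix (Fin N) (Fin n) ℍ)
    (C : Matrix (Fin n) (Fin N) ℍ) (D : Matrix (Fin n) (Fin n) ℍ) (x : Fin N → ℍ)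
    (u : ℕ → Fin n → ℍ) (k : ℕ) : Fin n → ℍ :=
  C *ᵥ stateSeq A B x u k + D *ᵥ u k

/-- The energy of the inputs minus the energy of the outputs, up to time `m`. -/
def supply (A : Matrix (Fin N) (Fin N) ℍ) (B : Matrix (Fin N) (Fin n) ℍ)
    (C : Matrix (Fin n) (Fin N) ℍ) (D : Matrix (Fin n) (Fin n) ℍ) (x : Fin N → ℍ)
    (u : ℕ → Fin n → ℍ) (m : ℕ) : ℝ :=
  ∑ k ∈ Finset.range m, (reInner (u k) (u k) -
    reInner (outputSeq A B C D x u k) (outputSeq A B C D x u k))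

/-- The possible supplies along trajectories from `x` to `0`. -/
def supplySet (A : Matrix (Fin N) (Fin N) ℍ) (B : Matrix (Fin N) (Fin n) ℍ)
    (C : Matrix (Fin n) (Fin N) ℍ) (D : Matrix (Fin n) (Fin n) ℍ) (x : Fin N → ℍ) : Set ℝ :=
  {c | ∃ u m, Steers A B x u m ∧ c = supply A B C D x u m}

/-- The least supply along trajectories from `x` to `0`. -/
def storage (A : Matrix (Fin N) (Fin N) ℍ) (B : Matrix (Fin N) (Fin n) ℍ)
    (C : Matrix (Fin n) (Fin N) ℍ) (D : Matrix (Fin n) (Fin n) ℍ) (x : Fin N → ℍ) : ℝ :=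
  sInf (supplySet A B C D x)

theorem stateSeq_add (x y : Fin N → ℍ) (u v : ℕ → Fin n → ℍ) (k : ℕ) :
    stateSeq A B (x + y) (u + v) k = stateSeq A B x u k + stateSeq A B y v k := by
  induction k with
  | zero => rfl
  | succ k ih =>
    simp only [stateSeq, ih, Pi.add_apply, Matrix.mulVec_add]
    abel

theorem stateSeq_sub (x y : Fin N → ℍ) (u v : ℕ → Fin n → ℍ) (k : ℕ) :
    stateSeq A B (x - y) (u - v) k = stateSeq A B x u k - stateSeq A B y v k := by
  induction k with
  | zero => rfl
  | succ k ih =>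
    simp only [stateSeq, ih, Pi.sub_apply, Matrix.mulVec_sub]
    abel

theorem stateSeq_op_smul (c : ℍ) (x : Fin N → ℍ) (u : ℕ → Fin n → ℍ) (k : ℕ) :
    stateSeq A B (MulOpposite.op c • x) (fun k => MulOpposite.op c • u k) k =
      MulOpposite.op c • stateSeq A B x u k := by
  induction k with
  | zero => rfl
  | succ k ih => simp only [stateSeq, ih, mulVec_op_smul, smul_add]

theorem stateSeq_succ (x : Fin N → ℍ) (u : ℕ → Fin n → ℍ) (k : ℕ) :
    stateSeq A B x u (k + 1) = stateSeq A B (A *ᵥ x + B *ᵥ u 0) (fun k => u (k + 1)) k := by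
  induction k with
  | zero => rfl
  | succ k ih => rw [stateSeq, ih, stateSeq]

theorem Steers.succ {x : Fin N → ℍ} {u : ℕ → Fin n → ℍ} {m : ℕ} (h : Steers A B x u m) :
    Steers A B x u (m + 1) ∧ supply A B C D x u (m + 1) = supply A B C D x u m := by
  refine ⟨⟨fun k hk => h.1 k (by omega), ?_⟩, ?_⟩
  · rw [stateSeq, h.2, h.1 m le_rfl, Matrix.mulVec_zero, Matrix.mulVec_zero, add_zero]
  · rw [supply, Finset.sum_range_succ, outputSeq, h.2, h.1 m le_rfl]
    simp [supply]

theorem Steers.mono {x : Fin N → ℍ} {u : ℕ → Fin n → ℍ} {m k : ℕ} (h : Steers A B x u m)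
    (hk : m ≤ k) : Steers A B x u k ∧ supply A B C D x u k = supply A B C D x u m := by
  induction k, hk using Nat.le_induction with
  | base => exact ⟨h, rfl⟩
  | succ k _ ih => exact ⟨(ih.1.succ (C := C) (D := D)).1, ih.1.succ.2.trans ih.2⟩

theorem Steers.add {x y : Fin N → ℍ} {u v : ℕ → Fin n → ℍ} {m : ℕ} (h : Steers A B x u m)
    (h' : Steers A B y v m) : Steers A B (x + y) (u + v) m :=
  ⟨fun k hk => by rw [Pi.add_apply, h.1 k hk, h'.1 k hk, add_zero],
    by rw [stateSeq_add, h.2, h'.2, add_zero]⟩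

theorem Steers.sub {x y : Fin N → ℍ} {u v : ℕ → Fin n → ℍ} {m : ℕ} (h : Steers A B x u m)
    (h' : Steers A B y v m) : Steers A B (x - y) (u - v) m :=
  ⟨fun k hk => by rw [Pi.sub_apply, h.1 k hk, h'.1 k hk, sub_zero],
    by rw [stateSeq_sub, h.2, h'.2, sub_zero]⟩

theorem Steers.op_smul {x : Fin N → ℍ} {u : ℕ → Fin n → ℍ} {m : ℕ} (h : Steers A B x u m)
    (c : ℍ) : Steers A B (MulOpposite.op c • x) (fun k => MulOpposite.op c • u k) m :=
  ⟨fun k hk => by simp only [h.1 k hk, smul_zero], by rw [stateSeq_op_smul, h.2, smul_zero]⟩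

theorem supply_op_smul (c : ℍ) (x : Fin N → ℍ) (u : ℕ → Fin n → ℍ) (m : ℕ) :
    supply A B C D (MulOpposite.op c • x) (fun k => MulOpposite.op c • u k) m =
      ‖c‖ ^ 2 * supply A B C D x u m := by
  simp only [supply, outputSeq, stateSeq_op_smul, mulVec_op_smul, ← smul_add, reInner_op_smul,
    Finset.mul_sum, mul_sub]

theorem reInner_add_add_sub_sub (x y : Fin n → ℍ) :
    reInner (x + y) (x + y) + reInner (x - y) (x - y) = 2 * reInner x x + 2 * reInner y y := by
  simp only [map_add, map_sub, LinearMap.add_apply, LinearMap.sub_apply]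
  ring

theorem supply_add_supply_sub (x y : Fin N → ℍ) (u v : ℕ → Fin n → ℍ) (m : ℕ) :
    supply A B C D (x + y) (u + v) m + supply A B C D (x - y) (u - v) m =
      2 * supply A B C D x u m + 2 * supply A B C D y v m := by
  simp only [supply, outputSeq, stateSeq_add, stateSeq_sub, Finset.mul_sum,
    ← Finset.sum_add_distrib]
  refine Finset.sum_congr rfl fun k _ => ?_
  have h1 := reInner_add_add_sub_sub (u k) (v k)
  have h2 := reInner_add_add_sub_sub (C *ᵥ stateSeq A B x u k + D *ᵥ u k)
    (C *ᵥ stateSeq A B y v k + D *ᵥ v k)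
  rw [show ∀ a b : Fin N → ℍ, ∀ c d : Fin n → ℍ, C *ᵥ a + D *ᵥ c + (C *ᵥ b + D *ᵥ d) =
      C *ᵥ (a + b) + D *ᵥ (c + d) from fun a b c d => by simp only [Matrix.mulVec_add]; abel,
    show ∀ a b : Fin N → ℍ, ∀ c d : Fin n → ℍ, C *ᵥ a + D *ᵥ c - (C *ᵥ b + D *ᵥ d) =
      C *ᵥ (a - b) + D *ᵥ (c - d) from fun a b c d => by simp only [Matrix.mulVec_sub]; abel] at h2
  simp only [Pi.add_apply, Pi.sub_apply]
  linarith

/-- For an invertible `A`, a controllable system can be steered to `0` from any state. -/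
theorem exists_steers {A' : Matrix (Fin N) (Fin N) ℍ} (hA : A * A' = 1)
    (hspan : Submodule.span ℝ {x | ∃ (k : ℕ) (u : Fin n → ℍ), x = (A' ^ k * (A' * B)) *ᵥ u} = ⊤)
    (x : Fin N → ℍ) : ∃ u m, Steers A B x u m := by
  have hx : x ∈ Submodule.span ℝ {x | ∃ (k : ℕ) (u : Fin n → ℍ),
      x = (A' ^ k * (A' * B)) *ᵥ u} := by rw [hspan]; trivial
  induction hx using Submodule.span_induction with
  | mem x hx =>
    obtain ⟨k, w, rfl⟩ := hx
    refine ⟨Pi.single k (-w), k + 1, fun j hj => Pi.single_eq_of_ne (by omega) _, ?_⟩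
    have hstate : ∀ j, j ≤ k → stateSeq A B ((A' ^ k * (A' * B)) *ᵥ w) (Pi.single k (-w)) j =
        (A ^ j * (A' ^ k * (A' * B))) *ᵥ w := fun j hj => by
      induction j with
      | zero => rw [stateSeq, pow_zero, Matrix.one_mul]
      | succ j ih =>
        rw [stateSeq, ih (by omega), Pi.single_eq_of_ne (by omega), Matrix.mulVec_zero, add_zero,
          Matrix.mulVec_mulVec, ← Matrix.mul_assoc, ← pow_succ']
    rw [stateSeq, hstate k le_rfl, Pi.single_eq_same, Matrix.mulVec_mulVec, ← Matrix.mul_assoc,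
      ← Matrix.mul_assoc, ← pow_succ', ← Matrix.mul_assoc, mul_assoc, ← pow_succ]
    have hpow : ∀ j : ℕ, A ^ j * A' ^ j = 1 := fun j => by
      induction j with
      | zero => simp
      | succ j ih => rw [pow_succ, pow_succ', mul_assoc, ← mul_assoc A, hA, one_mul, ih]
    rw [hpow, Matrix.one_mul, Matrix.mulVec_neg, add_neg_cancel]
  | zero =>
    exact ⟨0, 0, fun _ _ => rfl, rfl⟩
  | add x y _ _ ihx ihy =>
    obtain ⟨u, m, hu⟩ := ihx
    obtain ⟨v, k, hv⟩ := ihy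
    exact ⟨u + v, max m k, (hu.mono (C := 0) (D := 0) (le_max_left m k)).1.add
      (hv.mono (C := 0) (D := 0) (le_max_right m k)).1⟩
  | smul r x _ ih =>
    obtain ⟨u, m, hu⟩ := ih
    have h := hu.op_smul (r : ℍ)
    rw [op_coe_smul] at h
    exact ⟨_, m, h⟩

theorem storage_le (hnonneg : ∀ x u m, Steers A B x u m → 0 ≤ supply A B C D x u m)
    {x : Fin N → ℍ} {c : ℝ} (hc : c ∈ supplySet A B C D x) : storage A B C D x ≤ c :=
  csInf_le ⟨0, by rintro _ ⟨u, m, h, rfl⟩; exact hnonneg x u m h⟩ hc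

/-- If no trajectory that ends in `0` has a negative supply, then the storage function is the
quadratic form of a positive semidefinite matrix, and it satisfies the dissipation inequality. -/
theorem exists_isHermitian_dissipation (hsteer : ∀ x, ∃ u m, Steers A B x u m)
    (hnonneg : ∀ x u m, Steers A B x u m → 0 ≤ supply A B C D x u m) :
    ∃ H : Matrix (Fin N) (Fin N) ℍ, H.IsHermitian ∧ (∀ x, 0 ≤ reInner x (H *ᵥ x)) ∧
      ∀ x u, reInner x (H *ᵥ x) + reInner (C *ᵥ x + D *ᵥ u) (C *ᵥ x + D *ᵥ u) ≤
        reInner (A *ᵥ x + B *ᵥ u) (H *ᵥ (A *ᵥ x + B *ᵥ u)) + reInner u u := by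
  have hne : ∀ x, (supplySet A B C D x).Nonempty := fun x => by
    obtain ⟨u, m, h⟩ := hsteer x
    exact ⟨_, u, m, h, rfl⟩
  have h0 : ∀ x, 0 ≤ storage A B C D x := fun x =>
    le_csInf (hne x) (by rintro _ ⟨u, m, h, rfl⟩; exact hnonneg x u m h)
  have hpar : ∀ x y, storage A B C D (x + y) + storage A B C D (x - y) ≤
      2 * storage A B C D x + 2 * storage A B C D y := fun x y => by
    have key : ∀ c ∈ supplySet A B C D x, ∀ d ∈ supplySet A B C D y,
        storage A B C D (x + y) + storage A B C D (x - y) ≤ 2 * c + 2 * d := by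
      rintro _ ⟨u, m, hu, rfl⟩ _ ⟨v, k, hv, rfl⟩
      obtain ⟨hu1, hu2⟩ := hu.mono (C := C) (D := D) (le_max_left m k)
      obtain ⟨hv1, hv2⟩ := hv.mono (C := C) (D := D) (le_max_right m k)
      rw [← hu2, ← hv2, ← supply_add_supply_sub]
      exact add_le_add (storage_le hnonneg ⟨_, _, hu1.add hv1, rfl⟩)
        (storage_le hnonneg ⟨_, _, hu1.sub hv1, rfl⟩)
    have h1 : ∀ d ∈ supplySet A B C D y,
        (storage A B C D (x + y) + storage A B C D (x - y) - 2 * d) / 2 ≤ storage A B C D x :=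
      fun d hd => le_csInf (hne x) fun c hc => by linarith [key c hc d hd]
    have h2 : (storage A B C D (x + y) + storage A B C D (x - y) - 2 * storage A B C D x) / 2 ≤
        storage A B C D y := le_csInf (hne y) fun d hd => by linarith [h1 d hd]
    linarith
  have hsmul : ∀ (c : ℍ) x, storage A B C D (MulOpposite.op c • x) ≤
      ‖c‖ ^ 2 * storage A B C D x := fun c x => by
    have key : ∀ d ∈ supplySet A B C D x,
        storage A B C D (MulOpposite.op c • x) ≤ ‖c‖ ^ 2 * d := by
      rintro _ ⟨u, m, hu, rfl⟩
      rw [← supply_op_smul]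
      exact storage_le hnonneg ⟨_, m, hu.op_smul c, rfl⟩
    by_cases hc : c = 0
    · obtain ⟨d, hd⟩ := hne x
      simpa [hc] using key d hd
    · have h2 : 0 < ‖c‖ ^ 2 := by positivity
      rw [← inv_mul_le_iff₀ h2]
      exact le_csInf (hne x) fun d hd => (inv_mul_le_iff₀ h2).2 (key d hd)
  have hdiss : ∀ x u, storage A B C D x + reInner (C *ᵥ x + D *ᵥ u) (C *ᵥ x + D *ᵥ u) ≤
      storage A B C D (A *ᵥ x + B *ᵥ u) + reInner u u := fun x u => by
    have key : storage A B C D x + reInner (C *ᵥ x + D *ᵥ u) (C *ᵥ x + D *ᵥ u) - reInner u u ≤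
        storage A B C D (A *ᵥ x + B *ᵥ u) := by
      refine le_csInf (hne _) ?_
      rintro _ ⟨v, m, hv, rfl⟩
      let w : ℕ → Fin n → ℍ := fun k => Nat.casesOn k u v
      have hstate : ∀ k, stateSeq A B x w (k + 1) = stateSeq A B (A *ᵥ x + B *ᵥ u) v k :=
        fun k => stateSeq_succ x w k
      have hw : Steers A B x w (m + 1) := by
        refine ⟨fun k hk => ?_, by rw [hstate, hv.2]⟩
        obtain ⟨j, rfl⟩ : ∃ j, k = j + 1 := ⟨k - 1, by omega⟩
        exact hv.1 j (by omega)
      have h1 := storage_le hnonneg ⟨_, _, hw, rfl⟩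
      rw [supply, Finset.sum_range_succ'] at h1
      simp only [outputSeq, hstate] at h1
      change _ ≤ supply A B C D (A *ᵥ x + B *ᵥ u) v m +
        (reInner u u - reInner (C *ᵥ x + D *ᵥ u) (C *ᵥ x + D *ᵥ u)) at h1
      linarith
    linarith
  obtain ⟨H, hH, hq⟩ := exists_isHermitian_of_parallelogram h0 hpar hsmul
  have hq' : ∀ x, reInner x (H *ᵥ x) = storage A B C D x := hq
  refine ⟨H, hH, fun x => ?_, fun x u => ?_⟩
  · rw [hq']; exact h0 x
  · rw [hq', hq']; exact hdiss x u

end Storage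

/-! ### The realization at real points -/

section RealPoints

open Filter Topology

variable {N n : ℕ} {A : Matrix (Fin N) (Fin N) ℍ} {B : Matrix (Fin N) (Fin n) ℍ}
  {C : Matrix (Fin n) (Fin N) ℍ} {D : Matrix (Fin n) (Fin n) ℍ}

/-- The explicit form of `C ⋆ (p I - A)^{-⋆}`, with `p = x + v`, `x` real and `v` imaginary. -/
theorem starMul_const_starResolvent (A : Matrix (Fin N) (Fin N) ℍ) (C : Matrix (Fin n) (Fin N) ℍ)
    (p : ℍ) : starMul (fun _ => C) (starResolvent A) p =
      C * ((p.re • 1 - A) * Ring.inverse (charMat A p)) -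
        p.im • (C * Ring.inverse (charMat A p)) := by
  have h1 : alphaPart (fun _ => C) p = C := by
    rw [alphaPart, ← two_smul ℝ C, smul_smul]; norm_num
  have h2 : betaPart (fun _ => C) p = 0 := by simp [betaPart]
  have h3 : sliceUnit p * (‖p.im‖ : ℍ) = p.im := by
    by_cases h : ‖p.im‖ = 0
    · rw [h, norm_eq_zero.1 h]; simp
    · rw [sliceUnit, smul_mul_assoc, Quaternion.mul_coe_eq_smul, smul_smul, inv_mul_cancel₀ h,
        one_smul]
  rw [starMul, h1, h2, (starResolvent_parts A p).1, (starResolvent_parts A p).2, Matrix.zero_mul,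
    Matrix.zero_mul, sub_zero, add_zero, Matrix.mul_neg, Matrix.mul_smul, smul_neg, ← smul_coe_mat ‖p.im‖,
    smul_smul, h3, ← sub_eq_add_neg]

theorem isUnit_charMat_coe {x : ℝ} (h : IsUnit (x • 1 - A)) : IsUnit (charMat A (x : ℍ)) := by
  rw [charMat_eq]
  simpa using h.mul h

theorem realization_coe {x : ℝ} (h : IsUnit (x • 1 - A)) :
    realization A B C D (x : ℍ) = D + C * Ring.inverse (x • 1 - A) * B := by
  have h1 : charMat A (x : ℍ) = (x • 1 - A) * (x • 1 - A) := by
    rw [charMat_eq]; simp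
  have h2 : (x • 1 - A) * Ring.inverse (charMat A (x : ℍ)) = Ring.inverse (x • 1 - A) := by
    refine ((Ring.eq_mul_inverse_iff_mul_eq _ _ _ (isUnit_charMat_coe h)).2 ?_).symm
    rw [h1, ← mul_assoc, Ring.inverse_mul_cancel _ h, one_mul]
  rw [realization, starMul_const_starResolvent, Quaternion.re_coe, h2, Quaternion.im_coe, zero_smul,
    sub_zero]

theorem schurKernel_coe (S : ℍ → Matrix (Fin n) (Fin n) ℍ) {x y : ℝ} (hx : |x| < 1)
    (hy : |y| < 1) : schurKernel S (x : ℍ) (y : ℍ) =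
      (1 - x * y)⁻¹ • (1 - S x * (S y)ᴴ : Matrix (Fin n) (Fin n) ℍ) := by
  have hxy : ‖x * y‖ < 1 := by
    rw [Real.norm_eq_abs, abs_mul]
    nlinarith [abs_nonneg x, abs_nonneg y]
  refine Matrix.ext fun i j => ?_
  rw [schurKernel, Matrix.of_apply, Matrix.smul_apply, ← tsum_geometric_of_norm_lt_one hxy,
    ← (summable_geometric_of_norm_lt_one hxy).tsum_smul_const]
  refine tsum_congr fun u => ?_
  rw [Quaternion.star_coe, ← Quaternion.coe_pow, ← Quaternion.coe_pow, Quaternion.coe_mul_eq_smul,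
    Quaternion.mul_coe_eq_smul, smul_smul, mul_pow, mul_comm]

/-- The positivity of the kernel at real points. -/
theorem IsPosDefKernelOn.sum_nonneg {S : ℍ → Matrix (Fin n) (Fin n) ℍ}
    (hS : IsPosDefKernelOn (schurKernel S) (Metric.ball 0 1)) {m : ℕ} (x : Fin m → ℝ)
    (hx : ∀ i, |x i| < 1) (η : Fin m → Fin n → ℍ) :
    0 ≤ ∑ i, ∑ j, (1 - x i * x j)⁻¹ * (reInner (η i) (η j) -
      reInner ((S (x i))ᴴ *ᵥ η i) ((S (x j))ᴴ *ᵥ η j)) := by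
  have h := (hS m (fun i => (x i : ℍ)) η fun i => by
    rw [mem_ball_zero_iff, Quaternion.norm_coe]; exact hx i).2 1
  refine h.trans_eq ?_
  simp only [dotProduct, Matrix.mulVec, Matrix.of_apply, Pi.star_apply, Pi.one_apply, star_one,
    one_mul, mul_one, re_sum]
  refine Finset.sum_congr rfl fun i _ => Finset.sum_congr rfl fun j _ => ?_
  have h1 : reInner (η i) (schurKernel S (x i) (x j) *ᵥ η j) = (1 - x i * x j)⁻¹ *
      (reInner (η i) (η j) - reInner ((S (x i))ᴴ *ᵥ η i) ((S (x j))ᴴ *ᵥ η j)) := by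
    rw [schurKernel_coe S (hx i) (hx j), Matrix.smul_mulVec, map_smul, smul_eq_mul,
      Matrix.sub_mulVec, map_sub, Matrix.one_mulVec, ← Matrix.mulVec_mulVec,
      reInner_mulVec (S (x i))]
  rw [← h1, reInner_apply, dotProduct, re_sum]
  rfl

/-- The pointwise bound at a real point that follows from the positivity of the kernel. -/
theorem IsPosDefKernelOn.reInner_mulVec_le {S : ℍ → Matrix (Fin n) (Fin n) ℍ}
    (hS : IsPosDefKernelOn (schurKernel S) (Metric.ball 0 1)) {x : ℝ} (hx : |x| < 1)
    (u : Fin n → ℍ) : reInner (S x *ᵥ u) (S x *ᵥ u) ≤ reInner u u := by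
  have h := hS.sum_nonneg (fun _ : Fin 1 => x) (fun _ => hx) (fun _ => S x *ᵥ u)
  simp only [Finset.univ_unique, Finset.sum_const, Finset.card_singleton, one_smul] at h
  have h0 : 0 < (1 - x * x)⁻¹ := inv_pos.2 (by nlinarith [abs_lt.1 hx])
  have h1 := nonneg_of_mul_nonneg_right h h0
  have h2 := two_mul_reInner_le ((S x)ᴴ *ᵥ (S x *ᵥ u)) u
  rw [← reInner_mulVec] at h2
  linarith

/-- Only finitely many real `x` are eigenvalues of `A`. -/
theorem eventually_isUnit (A : Matrix (Fin N) (Fin N) ℍ) :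
    ∀ᶠ x : ℝ in 𝓝[≠] 0, IsUnit (x • 1 - A) := by
  have hfin : {μ : ℝ | Module.End.HasEigenvalue (mulVecReal A) μ}.Finite :=
    Module.End.finite_hasEigenvalue _
  have h1 : ∀ᶠ x : ℝ in 𝓝 0, x ∉ {μ : ℝ | Module.End.HasEigenvalue (mulVecReal A) μ} \ {0} :=
    (hfin.subset Set.sdiff_subset).isClosed.isOpen_compl.mem_nhds (by simp)
  filter_upwards [h1.filter_mono nhdsWithin_le_nhds, self_mem_nhdsWithin] with x hx hx0
  refine isUnit_of_ker_eq_bot fun v hv => ?_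
  by_contra hne
  refine hx ⟨Module.End.hasEigenvalue_of_hasEigenvector (x := v)
    ⟨Module.End.mem_eigenspace_iff.2 ?_, hne⟩, hx0⟩
  rw [Matrix.sub_mulVec, Matrix.smul_mulVec, Matrix.one_mulVec, sub_eq_zero] at hv
  exact hv.symm

/-- If the realization is bounded near `0`, then minimality makes `A` invertible. -/
theorem isUnit_of_isBigO (hobs : ∀ x, (∀ k : ℕ, (C * A ^ k) *ᵥ x = 0) → x = 0)
    (hspan : Submodule.span ℝ {x | ∃ (k : ℕ) (u : Fin n → ℍ), x = (A ^ k * B) *ᵥ u} = ⊤)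
    (hbd : ∀ u, (fun x : ℝ => (C * Ring.inverse (x • 1 - A) * B) *ᵥ u) =O[𝓝[≠] 0]
      fun _ => (1 : ℝ)) : IsUnit A := by
  have hid : (fun x : ℝ => x) =O[𝓝[≠] 0] fun _ => (1 : ℝ) :=
    (tendsto_id.mono_left nhdsWithin_le_nhds).isBigO_one ℝ
  have hpow : ∀ (k : ℕ) u, (fun x : ℝ => (C * Ring.inverse (x • 1 - A) * (A ^ k * B)) *ᵥ u)
      =O[𝓝[≠] 0] fun _ => (1 : ℝ) := fun k u => by
    induction k with
    | zero => simpa using hbd u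
    | succ k ih =>
      have h1 : (fun x : ℝ => (C * Ring.inverse (x • 1 - A) * (A ^ (k + 1) * B)) *ᵥ u)
          =ᶠ[𝓝[≠] 0] fun x : ℝ => x • ((C * Ring.inverse (x • 1 - A) * (A ^ k * B)) *ᵥ u) -
            (C * (A ^ k * B)) *ᵥ u := by
        filter_upwards [eventually_isUnit A] with x hx
        have h2 : Ring.inverse (x • 1 - A) * A = x • Ring.inverse (x • 1 - A) - 1 := by
          have h3 := Ring.inverse_mul_cancel _ hx
          rw [mul_sub, mul_smul_comm, mul_one] at h3
          rw [eq_sub_iff_add_eq, add_comm, ← sub_eq_iff_eq_add.1 h3]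
        rw [pow_succ', Matrix.mul_assoc A, Matrix.mul_assoc C, ← Matrix.mul_assoc _ A, h2,
          Matrix.sub_mul, Matrix.one_mul, Matrix.mul_sub, Matrix.sub_mulVec, Matrix.smul_mul,
          Matrix.mul_smul, Matrix.smul_mulVec, Matrix.mul_assoc C]
      refine h1.trans_isBigO (Asymptotics.IsBigO.sub ?_ (Asymptotics.isBigO_const_const _ one_ne_zero _))
      simpa using hid.smul ih
  have hall : ∀ v, (fun x : ℝ => (C * Ring.inverse (x • 1 - A)) *ᵥ v)
      =O[𝓝[≠] 0] fun _ => (1 : ℝ) := fun v => by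
    have hv : v ∈ Submodule.span ℝ {x | ∃ (k : ℕ) (u : Fin n → ℍ), x = (A ^ k * B) *ᵥ u} := by
      rw [hspan]; trivial
    induction hv using Submodule.span_induction with
    | mem v hv =>
      obtain ⟨k, u, rfl⟩ := hv
      simpa [Matrix.mulVec_mulVec] using hpow k u
    | zero =>
      simp only [Matrix.mulVec_zero]
      exact Asymptotics.isBigO_zero _ _
    | add v w _ _ hv hw => simpa [Matrix.mulVec_add] using hv.add hw
    | smul r v _ hv => simpa [Matrix.mulVec_smul] using hv.const_smul_left r
  refine isUnit_of_ker_eq_bot fun v hv => hobs v fun k => ?_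
  obtain _ | k := k
  · -- Here `C (x - A)⁻¹ v = x⁻¹ C v` stays bounded.
    have h1 : Tendsto (fun x : ℝ => x • ((C * Ring.inverse (x • 1 - A)) *ᵥ v)) (𝓝[≠] 0) (𝓝 0) := by
      have h2 : (fun x : ℝ => x) =o[𝓝[≠] 0] fun _ => (1 : ℝ) :=
        (Asymptotics.isLittleO_one_iff ℝ).2 (tendsto_id.mono_left nhdsWithin_le_nhds)
      have h3 := h2.smul_isBigO (hall v)
      simp only [smul_eq_mul, mul_one] at h3
      exact (Asymptotics.isLittleO_one_iff ℝ).1 h3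
    have h2 : (fun x : ℝ => x • ((C * Ring.inverse (x • 1 - A)) *ᵥ v)) =ᶠ[𝓝[≠] 0]
        fun _ => C *ᵥ v := by
      filter_upwards [eventually_isUnit A] with x hx
      have h3 : x • v = (x • 1 - A) *ᵥ v := by
        rw [Matrix.sub_mulVec, hv, sub_zero, Matrix.smul_mulVec, Matrix.one_mulVec]
      rw [← Matrix.mulVec_smul, h3, Matrix.mulVec_mulVec, Matrix.mul_assoc,
        Ring.inverse_mul_cancel _ hx, Matrix.mul_one]
    rw [pow_zero, Matrix.mul_one]
    exact (tendsto_nhds_unique (h1.congr' h2) tendsto_const_nhds).symm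
  · rw [pow_succ, ← Matrix.mul_assoc, ← Matrix.mulVec_mulVec, hv, Matrix.mulVec_zero]

/-- For a minimal realization with a Schur extension, `A` is invertible, because the positivity of
the kernel bounds the values at real points near `0`. -/
theorem isUnit_of_contractive {S : ℍ → Matrix (Fin n) (Fin n) ℍ}
    (hS : IsPosDefKernelOn (schurKernel S) (Metric.ball 0 1))
    (heq : Set.EqOn S (realization A B C D) (starResolventSet A ∩ Metric.ball 0 1))
    (hobs : ∀ x, (∀ k : ℕ, (C * A ^ k) *ᵥ x = 0) → x = 0)
    (hspan : Submodule.span ℝ {x | ∃ (k : ℕ) (u : Fin n → ℍ), x = (A ^ k * B) *ᵥ u} = ⊤) :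
    IsUnit A := by
  refine isUnit_of_isBigO hobs hspan fun u => ?_
  have h1 : ∀ᶠ x : ℝ in 𝓝[≠] 0, |x| < 1 :=
    (continuous_abs.continuousAt.eventually_lt continuousAt_const (by simp)).filter_mono
      nhdsWithin_le_nhds
  have h2 : (fun x : ℝ => S x *ᵥ u) =O[𝓝[≠] 0] fun _ => (1 : ℝ) := by
    refine Asymptotics.IsBigO.of_bound (√(reInner u u)) ?_
    filter_upwards [h1] with x hx
    rw [norm_one, mul_one]
    refine (pi_norm_le_iff_of_nonneg (Real.sqrt_nonneg _)).2 fun i => Real.le_sqrt_of_sq_le ?_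
    refine le_trans ?_ (hS.reInner_mulVec_le hx u)
    rw [reInner_self]
    exact Finset.single_le_sum (f := fun i => ‖(S x *ᵥ u) i‖ ^ 2) (fun _ _ => by positivity)
      (Finset.mem_univ i)
  have h3 : (fun x : ℝ => (C * Ring.inverse (x • 1 - A) * B) *ᵥ u) =ᶠ[𝓝[≠] 0]
      fun x : ℝ => S x *ᵥ u - D *ᵥ u := by
    filter_upwards [h1, eventually_isUnit A] with x hx hu
    rw [heq ⟨isUnit_charMat_coe hu, by
      rw [mem_ball_zero_iff, Quaternion.norm_coe]; exact hx⟩, realization_coe hu,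
      Matrix.add_mulVec, add_sub_cancel_left]
  exact h3.trans_isBigO (h2.sub (Asymptotics.isBigO_const_const _ one_ne_zero _))

end RealPoints

/-! ### From the kernel to Toeplitz matrices -/

section Toeplitz

open Filter Topology

attribute [local instance] Matrix.linftyOpNormedRing Matrix.linftyOpNormedAlgebra

theorem completeSpace_matrix (N : ℕ) : CompleteSpace (Matrix (Fin N) (Fin N) ℍ) :=
  FiniteDimensional.complete ℝ _

variable {N n : ℕ} {A A' : Matrix (Fin N) (Fin N) ℍ} {B : Matrix (Fin N) (Fin n) ℍ}
  {C : Matrix (Fin n) (Fin N) ℍ} {D : Matrix (Fin n) (Fin n) ℍ}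

theorem continuousAt_ringInverse_smul_one_sub (h : IsUnit A) :
    ContinuousAt (fun x : ℝ => Ring.inverse (x • 1 - A)) 0 := by
  have := completeSpace_matrix N
  have h0 : IsUnit ((0 : ℝ) • 1 - A) := by simpa using h.neg
  obtain ⟨w, hw⟩ := h0
  have h1 := NormedRing.inverse_continuousAt w
  rw [hw] at h1
  have h2 : ContinuousAt (fun x : ℝ => x • (1 : Matrix (Fin N) (Fin N) ℍ) - A) 0 := by fun_prop
  exact ContinuousAt.comp (f := fun x : ℝ => x • (1 : Matrix (Fin N) (Fin N) ℍ) - A) h1 h2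

theorem tendsto_reInner {α ι : Type*} [Fintype ι] {l : Filter α} {f g : α → ι → ℍ} {a b : ι → ℍ}
    (hf : Tendsto f l (𝓝 a)) (hg : Tendsto g l (𝓝 b)) :
    Tendsto (fun x => reInner (f x) (g x)) l (𝓝 (reInner a b)) := by
  have h : ∀ v w : ι → ℍ, reInner v w = ∑ i, (star (v i) * w i).re := fun v w => by
    rw [reInner_apply, dotProduct, re_sum]; rfl
  simp only [h]
  refine tendsto_finsetSum _ fun i _ => ?_
  exact (Quaternion.continuous_re.tendsto _).comp
    (((tendsto_pi_nhds.1 hf i).star).mul (tendsto_pi_nhds.1 hg i))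

theorem tendsto_mulVec {α ι κ : Type*} [Fintype ι] {l : Filter α} {f : α → Matrix κ ι ℍ}
    {g : α → ι → ℍ} {a : Matrix κ ι ℍ} {b : ι → ℍ} (hf : Tendsto f l (𝓝 a))
    (hg : Tendsto g l (𝓝 b)) : Tendsto (fun x => f x *ᵥ g x) l (𝓝 (a *ᵥ b)) := by
  refine tendsto_pi_nhds.2 fun i => ?_
  simp only [Matrix.mulVec, dotProduct]
  exact tendsto_finsetSum _ fun j _ =>
    (tendsto_pi_nhds.1 (tendsto_pi_nhds.1 hf i) j).mul (tendsto_pi_nhds.1 hg j)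

/-- The impulse response: the Taylor coefficients at `0` of the realization, where `A'` is the
inverse of `A`. -/
def taylorCoeff (A' : Matrix (Fin N) (Fin N) ℍ) (B : Matrix (Fin N) (Fin n) ℍ)
    (C : Matrix (Fin n) (Fin N) ℍ) (D : Matrix (Fin n) (Fin n) ℍ) (k : ℕ) :
    Matrix (Fin n) (Fin n) ℍ :=
  (if k = 0 then D else 0) - C * (A' ^ (k + 1) * B)

/-- The entries of the lower triangular Toeplitz matrix of the Taylor coefficients. -/
def toeplitzEntry (A' : Matrix (Fin N) (Fin N) ℍ) (B : Matrix (Fin N) (Fin n) ℍ)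
    (C : Matrix (Fin n) (Fin N) ℍ) (D : Matrix (Fin n) (Fin n) ℍ) (b a : ℕ) :
    Matrix (Fin n) (Fin n) ℍ :=
  if a ≤ b then taylorCoeff A' B C D (b - a) else 0

theorem ringInverse_expansion (hA' : A' * A = 1) {x : ℝ} (hx : IsUnit (x • 1 - A)) (l : ℕ) :
    Ring.inverse (x • 1 - A) = -∑ k ∈ Finset.range l, x ^ k • A' ^ (k + 1) +
      x ^ l • (A' ^ l * Ring.inverse (x • 1 - A)) := by
  have h1 : Ring.inverse (x • 1 - A) = x • (A' * Ring.inverse (x • 1 - A)) - A' := by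
    have h2 := congrArg (A' * ·) (Ring.mul_inverse_cancel _ hx)
    simp only [sub_mul, mul_sub, smul_mul_assoc, one_mul, mul_one, mul_smul_comm, ← mul_assoc,
      hA'] at h2
    rw [eq_sub_iff_add_eq, add_comm, ← sub_eq_iff_eq_add.1 h2]
  induction l with
  | zero => simp
  | succ l ih =>
    have h3 : x ^ l • (A' ^ l * Ring.inverse (x • 1 - A)) =
        x ^ (l + 1) • (A' ^ (l + 1) * Ring.inverse (x • 1 - A)) - x ^ l • A' ^ (l + 1) := by
      nth_rewrite 1 [h1]
      rw [mul_sub, mul_smul_comm, smul_sub, smul_smul, ← mul_assoc, ← pow_succ, ← pow_succ]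
    nth_rewrite 1 [ih]
    rw [Finset.sum_range_succ, h3]
    abel

/-- The Taylor expansion of `xᵃ` times the realization, with remainder of order `m`. -/
theorem smul_realization_expansion (hA' : A' * A = 1) {x : ℝ} (hx : IsUnit (x • 1 - A)) {a m : ℕ}
    (ham : a < m) : x ^ a • realization A B C D (x : ℍ) =
      ∑ b ∈ Finset.range m, x ^ b • toeplitzEntry A' B C D b a +
        x ^ m • (C * (A' ^ (m - a) * Ring.inverse (x • 1 - A)) * B) := by
  obtain ⟨l, rfl⟩ : ∃ l, m = a + (l + 1) := ⟨m - a - 1, by omega⟩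
  have h1 : ∑ b ∈ Finset.range a, x ^ b • toeplitzEntry A' B C D b a = 0 :=
    Finset.sum_eq_zero fun b hb => by
      rw [toeplitzEntry, if_neg (by have := Finset.mem_range.1 hb; omega), smul_zero]
  have h2 : ∑ k ∈ Finset.range (l + 1), x ^ (a + k) • toeplitzEntry A' B C D (a + k) a =
      x ^ a • (D - C * (∑ k ∈ Finset.range (l + 1), x ^ k • A' ^ (k + 1)) * B) := by
    have h3 : ∀ k, toeplitzEntry A' B C D (a + k) a =
        (if k = 0 then D else 0) - C * (A' ^ (k + 1) * B) := fun k => by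
      rw [toeplitzEntry, if_pos (by omega), Nat.add_sub_cancel_left, taylorCoeff]
    simp only [h3, smul_sub, Finset.sum_sub_distrib, pow_add, mul_smul]
    congr 1
    · rw [Finset.sum_eq_single 0 (fun k _ hk => by rw [if_neg hk, smul_zero, smul_zero])
        (by simp), if_pos rfl, pow_zero, one_smul]
    · rw [Matrix.mul_assoc, Matrix.sum_mul, Matrix.mul_sum, Finset.smul_sum]
      refine Finset.sum_congr rfl fun k _ => ?_
      rw [Matrix.smul_mul, Matrix.mul_smul]
  rw [Finset.sum_range_add, h1, h2, zero_add, Nat.add_sub_cancel_left, realization_coe hx]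
  nth_rewrite 1 [ringInverse_expansion hA' hx (l + 1)]
  rw [pow_add x a, mul_smul, ← smul_add, Matrix.mul_add, Matrix.add_mul, Matrix.mul_neg,
    Matrix.neg_mul, Matrix.mul_smul, Matrix.smul_mul]
  congr 1
  abel

/-- The Gram form of the vectors `η i` with weights `(1 - x i x j)⁻¹` is the sum of the squared
norms of the first `m` moments and a remainder of the same type. -/
theorem sum_inv_one_sub_mul_reInner {m : ℕ} (k : ℕ) (x : Fin m → ℝ) (hx : ∀ i, |x i| < 1)
    (η : Fin m → Fin n → ℍ) : ∑ i, ∑ j, (1 - x i * x j)⁻¹ * reInner (η i) (η j) =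
      ∑ l ∈ Finset.range k, reInner (∑ i, x i ^ l • η i) (∑ i, x i ^ l • η i) +
        ∑ i, ∑ j, (1 - x i * x j)⁻¹ * reInner (x i ^ k • η i) (x j ^ k • η j) := by
  have h1 : ∀ i j, (1 - x i * x j)⁻¹ = ∑ l ∈ Finset.range k, x i ^ l * x j ^ l +
      (1 - x i * x j)⁻¹ * (x i ^ k * x j ^ k) := fun i j => by
    have h2 : 1 - x i * x j ≠ 0 := by
      have h3 : |x i * x j| < 1 := by
        rw [abs_mul]; nlinarith [hx i, hx j, abs_nonneg (x i), abs_nonneg (x j)]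
      linarith [(abs_lt.1 h3).2]
    have h3 := geom_sum_mul_neg (x i * x j) k
    simp only [← mul_pow]
    field_simp
    linarith
  have h4 : ∀ l, reInner (∑ i, x i ^ l • η i) (∑ i, x i ^ l • η i) =
      ∑ i, ∑ j, x i ^ l * x j ^ l * reInner (η i) (η j) := fun l => by
    simp only [map_sum, LinearMap.sum_apply, map_smul, LinearMap.smul_apply, smul_eq_mul,
      Finset.mul_sum]
    rw [Finset.sum_comm]
    exact Finset.sum_congr rfl fun i _ => Finset.sum_congr rfl fun j _ => by ring
  have h5 : ∑ l ∈ Finset.range k, reInner (∑ i, x i ^ l • η i) (∑ i, x i ^ l • η i) =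
      ∑ i, ∑ j, ∑ l ∈ Finset.range k, x i ^ l * x j ^ l * reInner (η i) (η j) := by
    simp only [h4]
    rw [Finset.sum_comm]
    exact Finset.sum_congr rfl fun i _ => Finset.sum_comm
  rw [h5]
  simp only [← Finset.sum_add_distrib]
  refine Finset.sum_congr rfl fun i _ => Finset.sum_congr rfl fun j _ => ?_
  simp only [map_smul, LinearMap.smul_apply, smul_eq_mul, ← Finset.sum_mul]
  nth_rewrite 1 [h1 i j]
  ring

theorem conjTranspose_real_smul (r : ℝ) (M : Matrix (Fin n) (Fin n) ℍ) : (r • M)ᴴ = r • Mᴴ :=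
  Matrix.ext fun i j => Quaternion.star_smul r (M j i)

/-- The adjoint of the Toeplitz matrix of the Taylor coefficients is a contraction. The kernel is
tested at the points `δ (i + 1)`, with vectors for which the first `m` moments are the given
vectors `ξ`; all other contributions vanish as `δ → 0`. -/
theorem sum_toeplitz_conjTranspose_le {S : ℍ → Matrix (Fin n) (Fin n) ℍ}
    (hS : IsPosDefKernelOn (schurKernel S) (Metric.ball 0 1))
    (heq : Set.EqOn S (realization A B C D) (starResolventSet A ∩ Metric.ball 0 1))
    (hA : A * A' = 1) (hA' : A' * A = 1) {m : ℕ} (ξ : Fin m → Fin n → ℍ) :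
    ∑ a : Fin m, reInner (∑ b : Fin m, (toeplitzEntry A' B C D b a)ᴴ *ᵥ ξ b)
      (∑ b : Fin m, (toeplitzEntry A' B C D b a)ᴴ *ᵥ ξ b) ≤ ∑ b, reInner (ξ b) (ξ b) := by
  have hAu : IsUnit A := ⟨⟨A, A', hA, hA'⟩, rfl⟩
  let t : Fin m → ℝ := fun i => i + 1
  let V : Matrix (Fin m) (Fin m) ℝ := Matrix.vandermonde t
  have ht : ∀ i, t i ≠ 0 := fun i => by positivity
  have hV : V⁻¹ * V = 1 := by
    refine Matrix.nonsing_inv_mul _ (isUnit_iff_ne_zero.2 (Matrix.det_vandermonde_ne_zero_iff.2 ?_))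
    intro i j hij
    have : (i : ℝ) = j := by simpa [t] using hij
    exact Fin.ext (by exact_mod_cast this)
  let x : ℝ → Fin m → ℝ := fun δ i => δ * t i
  let η : ℝ → Fin m → Fin n → ℍ := fun δ i => ∑ a : Fin m, (V⁻¹ a i * (δ⁻¹) ^ (a : ℕ)) • ξ a
  let z : ℝ → Fin m → Fin n → ℍ := fun δ i => x δ i ^ m • η δ i
  let ζ : ℝ → Fin m → Fin n → ℍ := fun δ i => (S (x δ i))ᴴ *ᵥ η δ i
  have hx0 : ∀ i, Tendsto (fun δ => x δ i) (𝓝[≠] 0) (𝓝 0) := fun i => by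
    have h1 : Tendsto (fun δ : ℝ => δ * t i) (𝓝 0) (𝓝 (0 * t i)) :=
      (continuous_mul_const (t i)).tendsto 0
    rw [zero_mul] at h1
    exact h1.mono_left nhdsWithin_le_nhds
  have hx1 : ∀ᶠ δ in 𝓝[≠] 0, ∀ i, |x δ i| < 1 := by
    refine eventually_all.2 fun i => ?_
    have h1 := (continuous_abs.tendsto (0 : ℝ)).comp (hx0 i)
    rw [abs_zero] at h1
    exact h1.eventually_lt_const one_pos
  have hxu : ∀ᶠ δ in 𝓝[≠] 0, ∀ i, IsUnit (x δ i • 1 - A) := by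
    refine eventually_all.2 fun i => ?_
    refine (tendsto_nhdsWithin_iff.2 ⟨hx0 i, ?_⟩).eventually (eventually_isUnit A)
    filter_upwards [self_mem_nhdsWithin] with δ hδ
    exact mul_ne_zero hδ (ht i)
  have hmoment : ∀ δ : ℝ, δ ≠ 0 → ∀ b : Fin m, ∑ i, x δ i ^ (b : ℕ) • η δ i = ξ b := by
    intro δ hδ b
    simp only [η, Finset.smul_sum, smul_smul]
    rw [Finset.sum_comm, Finset.sum_eq_single b]
    · rw [← Finset.sum_smul]
      have h1 : ∀ i, x δ i ^ (b : ℕ) * (V⁻¹ b i * δ⁻¹ ^ (b : ℕ)) = V⁻¹ b i * V i b := fun i => by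
        simp only [x, V, Matrix.vandermonde_apply, mul_pow, inv_pow]
        field_simp
      have h2 := congrFun (congrFun hV b) b
      rw [Matrix.mul_apply, Matrix.one_apply_eq] at h2
      rw [Finset.sum_congr rfl fun i _ => h1 i, h2, one_smul]
    · intro a _ hab
      rw [← Finset.sum_smul]
      have h1 : ∀ i, x δ i ^ (b : ℕ) * (V⁻¹ a i * δ⁻¹ ^ (a : ℕ)) =
          δ ^ (b : ℕ) * δ⁻¹ ^ (a : ℕ) * (V⁻¹ a i * V i b) := fun i => by
        simp only [x, V, Matrix.vandermonde_apply, mul_pow]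
        ring
      have h2 := congrFun (congrFun hV a) b
      rw [Matrix.mul_apply, Matrix.one_apply_ne hab] at h2
      rw [Finset.sum_congr rfl fun i _ => h1 i, ← Finset.mul_sum, h2, mul_zero, zero_smul]
    · simp
  have hz : ∀ i, Tendsto (fun δ => z δ i) (𝓝[≠] 0) (𝓝 0) := fun i => by
    have h1 : (fun δ => ∑ a : Fin m, (t i ^ m * V⁻¹ a i * δ ^ (m - a : ℕ)) • ξ a)
        =ᶠ[𝓝[≠] 0] fun δ => z δ i := by
      filter_upwards [self_mem_nhdsWithin] with δ hδ
      simp only [z, η, x, Finset.smul_sum, smul_smul]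
      refine Finset.sum_congr rfl fun a _ => ?_
      rw [pow_sub₀ δ hδ a.2.le, mul_pow, inv_pow]
      congr 1
      ring
    have h2 : Continuous fun δ : ℝ => ∑ a : Fin m, (t i ^ m * V⁻¹ a i * δ ^ (m - a : ℕ)) • ξ a := by
      fun_prop
    have h3 := h2.tendsto 0
    rw [Finset.sum_eq_zero fun a _ => by
      rw [zero_pow (by have := a.2; omega), mul_zero, zero_smul]] at h3
    exact (h3.mono_left nhdsWithin_le_nhds).congr' h1
  have hR : ∀ i, Tendsto (fun δ => Ring.inverse (x δ i • 1 - A)) (𝓝[≠] 0)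
      (𝓝 (Ring.inverse ((0 : ℝ) • 1 - A))) := fun i =>
    (continuousAt_ringInverse_smul_one_sub hAu).tendsto.comp (hx0 i)
  have hSx : ∀ᶠ δ in 𝓝[≠] 0, ∀ i, S (x δ i) = realization A B C D (x δ i : ℍ) := by
    filter_upwards [hx1, hxu] with δ h1 h2 i
    exact heq ⟨isUnit_charMat_coe (h2 i), by
      rw [mem_ball_zero_iff, Quaternion.norm_coe]; exact h1 i⟩
  have hrem : ∀ y : Fin m → ℝ → Fin n → ℍ, (∀ i, Tendsto (y i) (𝓝[≠] 0) (𝓝 0)) →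
      Tendsto (fun δ => ∑ i, ∑ j, (1 - x δ i * x δ j)⁻¹ * reInner (y i δ) (y j δ)) (𝓝[≠] 0)
        (𝓝 0) := fun y hy => by
    have h1 : Tendsto (fun δ => ∑ i, ∑ j, (1 - x δ i * x δ j)⁻¹ * reInner (y i δ) (y j δ))
        (𝓝[≠] 0) (𝓝 (∑ _i : Fin m, ∑ _j : Fin m,
          (1 - (0 : ℝ) * 0)⁻¹ * reInner (0 : Fin n → ℍ) 0)) := by
      refine tendsto_finsetSum _ fun i _ => tendsto_finsetSum _ fun j _ => ?_
      refine Tendsto.mul (Tendsto.inv₀ (tendsto_const_nhds.sub ((hx0 i).mul (hx0 j))) (by simp)) ?_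
      exact tendsto_reInner (hy i) (hy j)
    simpa using h1
  have hζz : ∀ i, Tendsto (fun δ => x δ i ^ m • ζ δ i) (𝓝[≠] 0) (𝓝 0) := fun i => by
    have h1 : (fun δ => (D + C * Ring.inverse (x δ i • 1 - A) * B)ᴴ *ᵥ z δ i) =ᶠ[𝓝[≠] 0]
        fun δ => x δ i ^ m • ζ δ i := by
      filter_upwards [hSx, hxu] with δ h2 h3
      simp only [ζ, z]
      rw [h2, realization_coe (h3 i), Matrix.mulVec_smul]
    have h4 : Continuous fun R : Matrix (Fin N) (Fin N) ℍ => (D + C * R * B)ᴴ := by fun_prop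
    have h5 := tendsto_mulVec ((h4.tendsto _).comp (hR i)) (hz i)
    rw [Matrix.mulVec_zero] at h5
    exact h5.congr' h1
  have hw : ∀ a : Fin m, Tendsto (fun δ => ∑ i, x δ i ^ (a : ℕ) • ζ δ i) (𝓝[≠] 0)
      (𝓝 (∑ b : Fin m, (toeplitzEntry A' B C D b a)ᴴ *ᵥ ξ b)) := fun a => by
    have h1 : (fun δ => ∑ b : Fin m, (toeplitzEntry A' B C D b a)ᴴ *ᵥ ξ b +
        ∑ i, (C * (A' ^ (m - a : ℕ) * Ring.inverse (x δ i • 1 - A)) * B)ᴴ *ᵥ z δ i) =ᶠ[𝓝[≠] 0]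
        fun δ => ∑ i, x δ i ^ (a : ℕ) • ζ δ i := by
      filter_upwards [hSx, hxu, self_mem_nhdsWithin] with δ h2 h3 h4
      have h5 : ∀ i, x δ i ^ (a : ℕ) • ζ δ i =
          ∑ b : Fin m, x δ i ^ (b : ℕ) • ((toeplitzEntry A' B C D b a)ᴴ *ᵥ η δ i) +
          (C * (A' ^ (m - a : ℕ) * Ring.inverse (x δ i • 1 - A)) * B)ᴴ *ᵥ z δ i := fun i => by
        have h6 := smul_realization_expansion (B := B) (C := C) (D := D) hA' (h3 i) a.2
        rw [← Fin.sum_univ_eq_sum_range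
          (fun b => x δ i ^ b • toeplitzEntry A' B C D b a)] at h6
        simp only [ζ, z]
        rw [h2, ← Matrix.smul_mulVec,
          show x δ i ^ (a : ℕ) • (realization A B C D (x δ i : ℍ))ᴴ =
            (x δ i ^ (a : ℕ) • realization A B C D (x δ i : ℍ))ᴴ from
              (conjTranspose_real_smul _ _).symm, h6, Matrix.conjTranspose_add,
          Matrix.conjTranspose_sum, Matrix.add_mulVec, Matrix.sum_mulVec]
        simp only [conjTranspose_real_smul, Matrix.smul_mulVec, Matrix.mulVec_smul]
      rw [Finset.sum_congr rfl fun i _ => h5 i, Finset.sum_add_distrib, Finset.sum_comm]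
      congr 1
      refine Finset.sum_congr rfl fun b _ => ?_
      rw [← hmoment δ h4 b, Matrix.mulVec_sum]
      simp only [Matrix.mulVec_smul]
    have h2 : ∀ i, Tendsto (fun δ =>
        (C * (A' ^ (m - a : ℕ) * Ring.inverse (x δ i • 1 - A)) * B)ᴴ *ᵥ z δ i) (𝓝[≠] 0) (𝓝 0) :=
      fun i => by
        have h3 : Continuous fun R : Matrix (Fin N) (Fin N) ℍ =>
          (C * (A' ^ (m - a : ℕ) * R) * B)ᴴ := by fun_prop
        have h4 := tendsto_mulVec ((h3.tendsto _).comp (hR i)) (hz i)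
        rwa [Matrix.mulVec_zero] at h4
    have h3 := (tendsto_const_nhds (x := ∑ b : Fin m, (toeplitzEntry A' B C D b a)ᴴ *ᵥ ξ b)).add
      (tendsto_finsetSum Finset.univ fun i _ => h2 i)
    rw [Finset.sum_const_zero, add_zero] at h3
    exact h3.congr' h1
  have hlim : Tendsto (fun δ => ∑ b, reInner (ξ b) (ξ b) +
      ∑ i, ∑ j, (1 - x δ i * x δ j)⁻¹ * reInner (z δ i) (z δ j) -
      (∑ a : Fin m, reInner (∑ i, x δ i ^ (a : ℕ) • ζ δ i) (∑ i, x δ i ^ (a : ℕ) • ζ δ i) +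
        ∑ i, ∑ j, (1 - x δ i * x δ j)⁻¹ *
          reInner (x δ i ^ m • ζ δ i) (x δ j ^ m • ζ δ j))) (𝓝[≠] 0)
      (𝓝 (∑ b, reInner (ξ b) (ξ b) + 0 -
        (∑ a : Fin m, reInner (∑ b : Fin m, (toeplitzEntry A' B C D b a)ᴴ *ᵥ ξ b)
          (∑ b : Fin m, (toeplitzEntry A' B C D b a)ᴴ *ᵥ ξ b) + 0))) :=
    (tendsto_const_nhds.add (hrem (fun i δ => z δ i) hz)).sub
      ((tendsto_finsetSum _ fun a _ => tendsto_reInner (hw a) (hw a)).add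
        (hrem (fun i δ => x δ i ^ m • ζ δ i) hζz))
  have hge := ge_of_tendsto (b := 0) hlim (by
    filter_upwards [hx1, self_mem_nhdsWithin] with δ h1 h2
    have h3 := hS.sum_nonneg (x δ) h1 (η δ)
    simp only [mul_sub, Finset.sum_sub_distrib] at h3
    rw [sum_inv_one_sub_mul_reInner m (x δ) h1 (η δ),
      sum_inv_one_sub_mul_reInner m (x δ) h1 (fun i => (S (x δ i))ᴴ *ᵥ η δ i),
      ← Fin.sum_univ_eq_sum_range
        (fun l => reInner (∑ i, x δ i ^ l • η δ i) (∑ i, x δ i ^ l • η δ i)),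
      ← Fin.sum_univ_eq_sum_range (fun l => reInner
        (∑ i, x δ i ^ l • ((S (x δ i))ᴴ *ᵥ η δ i)) (∑ i, x δ i ^ l • ((S (x δ i))ᴴ *ᵥ η δ i))),
      Finset.sum_congr rfl fun b _ => by rw [hmoment δ h2 b]] at h3
    exact h3)
  linarith

/-- The Toeplitz matrix of the Taylor coefficients is a contraction, since its adjoint is. -/
theorem sum_toeplitz_le {S : ℍ → Matrix (Fin n) (Fin n) ℍ}
    (hS : IsPosDefKernelOn (schurKernel S) (Metric.ball 0 1))
    (heq : Set.EqOn S (realization A B C D) (starResolventSet A ∩ Metric.ball 0 1))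
    (hA : A * A' = 1) (hA' : A' * A = 1) {m : ℕ} (v : Fin m → Fin n → ℍ) :
    ∑ b : Fin m, reInner (∑ a : Fin m, toeplitzEntry A' B C D b a *ᵥ v a)
      (∑ a : Fin m, toeplitzEntry A' B C D b a *ᵥ v a) ≤ ∑ a, reInner (v a) (v a) := by
  set y : Fin m → Fin n → ℍ := fun b => ∑ a : Fin m, toeplitzEntry A' B C D b a *ᵥ v a with hy
  have h1 := sum_toeplitz_conjTranspose_le hS heq hA hA' y
  have h2 : ∑ b, reInner (y b) (y b) =
      ∑ a : Fin m, reInner (∑ b : Fin m, (toeplitzEntry A' B C D b a)ᴴ *ᵥ y b) (v a) := by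
    have h3 : ∀ b, reInner (y b) (y b) =
        ∑ a : Fin m, reInner ((toeplitzEntry A' B C D b a)ᴴ *ᵥ y b) (v a) := fun b => by
      conv_lhs => rw [hy]
      simp only
      rw [map_sum]
      exact Finset.sum_congr rfl fun a _ => reInner_mulVec _ _ _
    rw [Finset.sum_congr rfl fun b _ => h3 b, Finset.sum_comm]
    exact Finset.sum_congr rfl fun a _ => by rw [map_sum, LinearMap.sum_apply]
  have h4 : 2 * ∑ a : Fin m, reInner (∑ b : Fin m, (toeplitzEntry A' B C D b a)ᴴ *ᵥ y b) (v a) ≤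
      ∑ a : Fin m, reInner (∑ b : Fin m, (toeplitzEntry A' B C D b a)ᴴ *ᵥ y b)
        (∑ b : Fin m, (toeplitzEntry A' B C D b a)ᴴ *ᵥ y b) + ∑ a, reInner (v a) (v a) := by
    rw [Finset.mul_sum, ← Finset.sum_add_distrib]
    exact Finset.sum_le_sum fun a _ => two_mul_reInner_le _ _
  linarith

/-- Along a trajectory that ends in `0`, the outputs carry at most the energy of the inputs: in
reversed time, they are the image of the inputs under the Toeplitz matrix of the Taylor
coefficients. -/
theorem supply_nonneg {S : ℍ → Matrix (Fin n) (Fin n) ℍ}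
    (hS : IsPosDefKernelOn (schurKernel S) (Metric.ball 0 1))
    (heq : Set.EqOn S (realization A B C D) (starResolventSet A ∩ Metric.ball 0 1))
    (hA : A * A' = 1) (hA' : A' * A = 1) (x : Fin N → ℍ) (u : ℕ → Fin n → ℍ) (m : ℕ)
    (hu : Steers A B x u m) : 0 ≤ supply A B C D x u m := by
  have hstate : ∀ j, j ≤ m → stateSeq A B x u (m - j) =
      -∑ i ∈ Finset.range j, (A' ^ (j - i) * B) *ᵥ u (m - 1 - i) := fun j hj => by
    induction j with
    | zero => simpa using hu.2
    | succ j ih =>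
      have h1 := ih (by omega)
      rw [show m - j = m - (j + 1) + 1 by omega, stateSeq] at h1
      have h2 := congrArg (A' *ᵥ ·) h1
      simp only [Matrix.mulVec_add, Matrix.mulVec_mulVec, hA', Matrix.one_mulVec, Matrix.mulVec_neg,
        Matrix.mulVec_sum, ← Matrix.mul_assoc, ← pow_succ'] at h2
      rw [Finset.sum_range_succ, Nat.add_sub_cancel_left, pow_one, neg_add,
        show m - 1 - j = m - (j + 1) by omega, ← sub_eq_add_neg, eq_sub_iff_add_eq, h2]
      congr 1
      refine Finset.sum_congr rfl fun i hi => ?_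
      rw [show j + 1 - i = j - i + 1 by have := Finset.mem_range.1 hi; omega]
  have hout : ∀ j : Fin m, outputSeq A B C D x u (m - 1 - j) =
      ∑ i : Fin m, toeplitzEntry A' B C D j i *ᵥ u (m - 1 - i) := fun j => by
    have hj := j.2
    rw [Fin.sum_univ_eq_sum_range (fun i => toeplitzEntry A' B C D j i *ᵥ u (m - 1 - i)),
      ← Finset.sum_subset (Finset.range_mono (show (j : ℕ) + 1 ≤ m by omega)) fun i _ hi => by
        rw [toeplitzEntry, if_neg (by simpa using hi), Matrix.zero_mulVec],
      outputSeq, show m - 1 - (j : ℕ) = m - (j + 1) by omega, hstate _ (show (j : ℕ) + 1 ≤ m from hj),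
      Finset.sum_range_succ, Finset.sum_range_succ, Matrix.mulVec_neg, Matrix.mulVec_add,
      Matrix.mulVec_sum, Matrix.mulVec_mulVec]
    have h1 : ∀ i ∈ Finset.range (j : ℕ), toeplitzEntry A' B C D j i *ᵥ u (m - 1 - i) =
        -(C *ᵥ ((A' ^ ((j : ℕ) + 1 - i) * B) *ᵥ u (m - 1 - i))) := fun i hi => by
      have hi' := Finset.mem_range.1 hi
      rw [toeplitzEntry, if_pos hi'.le, taylorCoeff, if_neg (by omega), zero_sub,
        Matrix.neg_mulVec, Matrix.mulVec_mulVec, show (j : ℕ) - i + 1 = j + 1 - i by omega]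
    rw [Finset.sum_congr rfl h1, toeplitzEntry, if_pos le_rfl, taylorCoeff, if_pos (by omega),
      Finset.sum_neg_distrib, Matrix.sub_mulVec, Nat.sub_self, Nat.add_sub_cancel_left,
      show m - 1 - (j : ℕ) = m - (j + 1) by omega, zero_add]
    abel
  have h1 := sum_toeplitz_le hS heq hA hA' fun i : Fin m => u (m - 1 - i)
  simp only [← hout] at h1
  rw [supply, ← Finset.sum_range_reflect, Finset.sum_sub_distrib, sub_nonneg]
  rwa [Fin.sum_univ_eq_sum_range (fun i => reInner (u (m - 1 - i)) (u (m - 1 - i))),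
    Fin.sum_univ_eq_sum_range (fun i => reInner (outputSeq A B C D x u (m - 1 - i))
      (outputSeq A B C D x u (m - 1 - i)))] at h1

end Toeplitz

/-! ### The dissipation inequality as a matrix inequality -/

section Dissipation

open Filter Topology

variable {N n : ℕ} {A A' H : Matrix (Fin N) (Fin N) ℍ} {B : Matrix (Fin N) (Fin n) ℍ}
  {C : Matrix (Fin n) (Fin N) ℍ} {D : Matrix (Fin n) (Fin n) ℍ}

theorem isPosSemidef_fromBlocks_iff (hH : H.IsHermitian) :
    IsPosSemidef (Matrix.fromBlocks H 0 0 (1 : Matrix (Fin n) (Fin n) ℍ) -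
      (Matrix.fromBlocks A B C D)ᴴ * Matrix.fromBlocks H 0 0 (1 : Matrix (Fin n) (Fin n) ℍ) *
        Matrix.fromBlocks A B C D) ↔
    ∀ x u, reInner (A *ᵥ x + B *ᵥ u) (H *ᵥ (A *ᵥ x + B *ᵥ u)) +
      reInner (C *ᵥ x + D *ᵥ u) (C *ᵥ x + D *ᵥ u) ≤ reInner x (H *ᵥ x) + reInner u u := by
  have hsum : ∀ (a c : Fin N → ℍ) (b d : Fin n → ℍ),
      reInner (Sum.elim a b) (Sum.elim c d) = reInner a c + reInner b d := fun a c b d => by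
    simp only [reInner_apply, dotProduct, Fintype.sum_sum_type, Pi.star_apply, Sum.elim_inl,
      Sum.elim_inr, Quaternion.re_add]
  have hJ : ∀ (a : Fin N → ℍ) (b : Fin n → ℍ),
      reInner (Sum.elim a b)
        (Matrix.fromBlocks H 0 0 (1 : Matrix (Fin n) (Fin n) ℍ) *ᵥ Sum.elim a b) =
        reInner a (H *ᵥ a) + reInner b b := fun a b => by
    rw [Matrix.fromBlocks_mulVec]
    simp [hsum]
  have hq : ∀ (x : Fin N → ℍ) (u : Fin n → ℍ), (star (Sum.elim x u) ⬝ᵥ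
      ((Matrix.fromBlocks H 0 0 (1 : Matrix (Fin n) (Fin n) ℍ) -
      (Matrix.fromBlocks A B C D)ᴴ * Matrix.fromBlocks H 0 0 (1 : Matrix (Fin n) (Fin n) ℍ) *
        Matrix.fromBlocks A B C D) *ᵥ Sum.elim x u)).re =
      reInner x (H *ᵥ x) + reInner u u - (reInner (A *ᵥ x + B *ᵥ u) (H *ᵥ (A *ᵥ x + B *ᵥ u)) +
      reInner (C *ᵥ x + D *ᵥ u) (C *ᵥ x + D *ᵥ u)) := fun x u => by
    rw [← reInner_apply, Matrix.sub_mulVec, map_sub, hJ, ← Matrix.mulVec_mulVec,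
      ← Matrix.mulVec_mulVec, reInner_mulVec (Matrix.fromBlocks A B C D)ᴴ,
      Matrix.conjTranspose_conjTranspose,
      show Matrix.fromBlocks A B C D *ᵥ Sum.elim x u =
        Sum.elim (A *ᵥ x + B *ᵥ u) (C *ᵥ x + D *ᵥ u) by rw [Matrix.fromBlocks_mulVec]; rfl, hJ]
  constructor
  · intro h x u
    have h1 := h.2 (Sum.elim x u)
    rw [hq] at h1
    linarith
  · intro h
    refine ⟨?_, fun z => ?_⟩
    · have h1 : (Matrix.fromBlocks H 0 0 (1 : Matrix (Fin n) (Fin n) ℍ)).IsHermitian :=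
        Matrix.IsHermitian.fromBlocks hH (by simp) Matrix.isHermitian_one
      exact h1.sub (Matrix.isHermitian_conjTranspose_mul_mul _ h1)
    · rw [← Sum.elim_comp_inl_inr z, hq]
      linarith [h (z ∘ Sum.inl) (z ∘ Sum.inr)]

/-- The storage function of a contractive minimal realization is positive definite. -/
theorem exists_isNegDef_of_contractive
    (hobs : ∀ x, (∀ k : ℕ, (C * A ^ k) *ᵥ x = 0) → x = 0)
    (hctr : ∀ x, (∀ k : ℕ, (Bᴴ * Aᴴ ^ k) *ᵥ x = 0) → x = 0)
    (h : IsContractiveInUnitBall (realization A B C D) (starResolventSet A)) :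
    ∃ H : Matrix (Fin N) (Fin N) ℍ, IsNegDef H ∧
      IsPosSemidef (Matrix.fromBlocks H 0 0 (1 : Matrix (Fin n) (Fin n) ℍ) -
        (Matrix.fromBlocks A B C D)ᴴ * Matrix.fromBlocks H 0 0 (1 : Matrix (Fin n) (Fin n) ℍ) *
          Matrix.fromBlocks A B C D) := by
  obtain ⟨S, -, heq, hS⟩ := h
  obtain ⟨⟨A, A', hA, hA'⟩, rfl⟩ :=
    isUnit_of_contractive hS heq hobs (span_range_pow_mul_mulVec A B hctr)
  simp only at hobs hctr heq ⊢
  have hctr' : ∀ w, (∀ k : ℕ, ((A' * B)ᴴ * A'ᴴ ^ k) *ᵥ w = 0) → w = 0 := fun w hw => by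
    refine eq_zero_of_inverse_observable (A' := A'ᴴ) hctr
      (by rw [← Matrix.conjTranspose_mul, hA', Matrix.conjTranspose_one])
      (by rw [← Matrix.conjTranspose_mul, hA, Matrix.conjTranspose_one]) fun k => ?_
    have h1 := hw k
    rwa [Matrix.conjTranspose_mul, Matrix.mul_assoc, ← pow_succ'] at h1
  obtain ⟨K, hK, hK0, hdiss⟩ := exists_isHermitian_dissipation (C := C) (D := D)
    (exists_steers hA (span_range_pow_mul_mulVec A' (A' * B) hctr'))
    (supply_nonneg hS heq hA hA')
  have hKneg : ∀ v, reInner v ((-K) *ᵥ v) = -reInner v (K *ᵥ v) := fun v => by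
    rw [Matrix.neg_mulVec, map_neg]
  refine ⟨-K, ⟨hK.neg, fun x hx => ?_⟩, (isPosSemidef_fromBlocks_iff hK.neg).2 fun x u => ?_⟩
  · rw [← reInner_apply, hKneg, neg_lt_zero]
    refine lt_of_le_of_ne (hK0 x) fun hx0 => hx ?_
    have hstep : ∀ z, reInner (A' *ᵥ z) (K *ᵥ (A' *ᵥ z)) +
        reInner ((C * A') *ᵥ z) ((C * A') *ᵥ z) ≤ reInner z (K *ᵥ z) := fun z => by
      have h1 := hdiss (A' *ᵥ z) 0
      simpa [Matrix.mulVec_mulVec, ← Matrix.mul_assoc, hA] using h1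
    have hzero : ∀ k : ℕ, reInner (A' ^ k *ᵥ x) (K *ᵥ (A' ^ k *ᵥ x)) = 0 := fun k => by
      induction k with
      | zero => rw [pow_zero, Matrix.one_mulVec]; exact hx0.symm
      | succ k ih =>
        have h1 := hstep (A' ^ k *ᵥ x)
        rw [Matrix.mulVec_mulVec _ A', ← pow_succ', ih] at h1
        exact le_antisymm (by linarith [reInner_self_nonneg ((C * A') *ᵥ A' ^ k *ᵥ x)]) (hK0 _)
    refine eq_zero_of_inverse_observable hobs hA hA' fun k => ?_
    have h1 := hstep (A' ^ k *ᵥ x)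
    rw [hzero k, Matrix.mulVec_mulVec x (C * A'), Matrix.mul_assoc, ← pow_succ'] at h1
    exact reInner_self_eq_zero.1 (le_antisymm (by linarith [hK0 (A' *ᵥ A' ^ k *ᵥ x)])
      (reInner_self_nonneg _))
  · rw [hKneg, hKneg]
    linarith [hdiss x u]

/-- The dissipation inequality of the dual system, with the inverse storage matrix `P`. -/
theorem dual_dissipation {K P : Matrix (Fin N) (Fin N) ℍ} (hK : K.IsHermitian)
    (hK0 : ∀ x, 0 ≤ reInner x (K *ᵥ x)) (hKP : K * P = 1) (hA : A * A' = 1)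
    (hdiss : ∀ x u, reInner x (K *ᵥ x) + reInner (C *ᵥ x + D *ᵥ u) (C *ᵥ x + D *ᵥ u) ≤
      reInner (A *ᵥ x + B *ᵥ u) (K *ᵥ (A *ᵥ x + B *ᵥ u)) + reInner u u)
    (e : Fin N → ℍ) (b : Fin n → ℍ) :
    reInner e (P *ᵥ e) + reInner (Bᴴ *ᵥ e + Dᴴ *ᵥ b) (Bᴴ *ᵥ e + Dᴴ *ᵥ b) ≤
      reInner (Aᴴ *ᵥ e + Cᴴ *ᵥ b) (P *ᵥ (Aᴴ *ᵥ e + Cᴴ *ᵥ b)) + reInner b b := by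
  set a := Aᴴ *ᵥ e + Cᴴ *ᵥ b with ha
  set v := Bᴴ *ᵥ e + Dᴴ *ᵥ b with hv
  have hKPv : ∀ w, K *ᵥ (P *ᵥ w) = w := fun w => by
    rw [Matrix.mulVec_mulVec, hKP, Matrix.one_mulVec]
  -- The primal inequality is used for the trajectory that ends in `P e` with input `-v`.
  let x := A' *ᵥ (P *ᵥ e + B *ᵥ v)
  have hx : A *ᵥ x = P *ᵥ e + B *ᵥ v := by
    rw [Matrix.mulVec_mulVec, hA, Matrix.one_mulVec]
  have h1 := hdiss x (-v)
  rw [hx, Matrix.mulVec_neg, Matrix.mulVec_neg, add_neg_cancel_right, hKPv,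
    reInner_comm (P *ᵥ e)] at h1
  simp only [map_neg, LinearMap.neg_apply, neg_neg] at h1
  have h2 : reInner e (P *ᵥ e) + reInner v v = reInner a x + reInner b (D *ᵥ v - C *ᵥ x) := by
    have h3 : reInner e (A *ᵥ x) = reInner e (P *ᵥ e) + reInner e (B *ᵥ v) := by
      rw [hx, map_add]
    have h4 : reInner v v = reInner e (B *ᵥ v) + reInner b (D *ᵥ v) := by
      rw [reInner_mulVec B, reInner_mulVec D, ← LinearMap.add_apply, ← map_add]
    have h5 : reInner a x = reInner e (A *ᵥ x) + reInner b (C *ᵥ x) := by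
      rw [ha, map_add, LinearMap.add_apply, reInner_mulVec A, reInner_mulVec C]
    rw [map_sub]
    linarith
  have h6 : 2 * reInner a x ≤ reInner a (P *ᵥ a) + reInner x (K *ᵥ x) := by
    have h7 := hK0 (x - P *ᵥ a)
    have h8 : reInner (P *ᵥ a) (K *ᵥ x) = reInner a x := by
      rw [reInner_mulVec, hK.eq, hKPv]
    rw [Matrix.mulVec_sub, hKPv, map_sub, map_sub, LinearMap.sub_apply, LinearMap.sub_apply, h8,
      reInner_comm x a, reInner_comm (P *ᵥ a) a] at h7
    linarith
  have h9 := two_mul_reInner_le b (D *ᵥ v - C *ᵥ x)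
  have h10 : reInner (D *ᵥ v - C *ᵥ x) (D *ᵥ v - C *ᵥ x) =
      reInner (C *ᵥ x + -(D *ᵥ v)) (C *ᵥ x + -(D *ᵥ v)) := by
    rw [show C *ᵥ x + -(D *ᵥ v) = -(D *ᵥ v - C *ᵥ x) by abel]
    simp only [map_neg, LinearMap.neg_apply, neg_neg]
  linarith

/-- If `A` does not decrease a positive definite form, then its `S`-spectrum does not meet the open
unit ball: `A² - 2 Re(p) A + |p|²` is the product of `A - p` and `A - p̄`, where the quaternions
`p` and `p̄` act by multiplication from the right. -/
theorem isUnit_charMat_of_norm_lt_one {K : Matrix (Fin N) (Fin N) ℍ}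
    (hKpos : ∀ x, x ≠ 0 → 0 < reInner x (K *ᵥ x))
    (hKA : ∀ x, reInner x (K *ᵥ x) ≤ reInner (A *ᵥ x) (K *ᵥ (A *ᵥ x))) {p : ℍ} (hp : ‖p‖ < 1) :
    IsUnit (charMat A p) := by
  have hinj : ∀ (c : ℍ) x, ‖c‖ < 1 → A *ᵥ x = MulOpposite.op c • x → x = 0 := fun c x hc hx => by
    by_contra hne
    have h1 := hKA x
    rw [hx, mulVec_op_smul, reInner_op_smul] at h1
    have h2 := hKpos x hne
    have h3 : ‖c‖ ^ 2 < 1 := by nlinarith [norm_nonneg c]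
    nlinarith
  refine isUnit_of_ker_eq_bot fun v hv => ?_
  have h1 : A *ᵥ (A *ᵥ v - MulOpposite.op (star p) • v) =
      MulOpposite.op p • (A *ᵥ v - MulOpposite.op (star p) • v) := by
    rw [charMat, Matrix.add_mulVec, Matrix.sub_mulVec, Matrix.smul_mulVec, Matrix.smul_mulVec,
      Matrix.one_mulVec, ← Matrix.mulVec_mulVec, ← op_coe_smul, ← op_coe_smul] at hv
    have h2 : ((2 * p.re : ℝ) : ℍ) = p + star p := (Quaternion.self_add_star' p).symm
    have h3 : ((‖p‖ ^ 2 : ℝ) : ℍ) = star p * p := by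
      rw [Quaternion.star_mul_self, Quaternion.normSq_eq_norm_mul_self, pow_two]
    rw [h2, h3, MulOpposite.op_add, MulOpposite.op_mul, add_smul, mul_smul] at hv
    rw [Matrix.mulVec_sub, mulVec_op_smul, smul_sub, sub_eq_zero.symm, ← hv]
    abel
  have h2 := sub_eq_zero.1 (hinj p _ hp h1)
  exact hinj _ v (by rwa [norm_star]) h2

end Dissipation

/-! ### Positivity of the kernel -/

section Kernel

open Filter Topology

variable {N n : ℕ} {A A' : Matrix (Fin N) (Fin N) ℍ} {B : Matrix (Fin N) (Fin n) ℍ}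
  {C : Matrix (Fin n) (Fin N) ℍ} {D : Matrix (Fin n) (Fin n) ℍ}

theorem smul_starMul_const_starResolvent {p : ℍ} (hp : IsUnit (charMat A p)) :
    p • starMul (fun _ => C) (starResolvent A) p =
      starMul (fun _ => C) (starResolvent A) p * A + C := by
  have h0 := Ring.mul_inverse_cancel _ hp
  have hc : Commute A (charMat A p) := by
    rw [charMat]
    refine ((Commute.refl A).mul_right (Commute.refl A)).sub_right
      ((Commute.refl A).smul_right _) |>.add_right ((Commute.one_right A).smul_right _)
  have hc' : Ring.inverse (charMat A p) * A = A * Ring.inverse (charMat A p) :=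
    (Ring.inverse_mul_eq_iff_eq_mul _ _ _ hp).2 (by
      rw [← mul_assoc, ← hc.eq, mul_assoc, h0, mul_one])
  rw [starMul_const_starResolvent]
  set G := Ring.inverse (charMat A p) with hG
  have h1 : charMat A p * G = (p.re • 1 - A) * (p.re • 1 - A) * G + ‖p.im‖ ^ 2 • G := by
    rw [charMat_eq, add_mul, smul_mul_assoc, one_mul]
  rw [h0] at h1
  have hv : p.im * p.im = ((-‖p.im‖ ^ 2 : ℝ) : ℍ) := by
    have h3 : p.im * p.im = -((Quaternion.normSq p.im : ℝ) : ℍ) := by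
      rw [← Quaternion.self_mul_star, Quaternion.star_eq_neg.2 (by simp)]; simp
    rw [h3, Quaternion.normSq_eq_norm_mul_self, ← Quaternion.coe_neg, pow_two]
  have h2 : p = (p.re : ℍ) + p.im := (Quaternion.re_add_im p).symm
  have h4 : C = C * ((p.re • 1 - A) * (p.re • 1 - A) * G) + ‖p.im‖ ^ 2 • (C * G) := by
    rw [← Matrix.mul_smul, ← Matrix.mul_add, ← h1, Matrix.mul_one]
  nth_rewrite 1 [h2]
  nth_rewrite 5 [h4]
  rw [add_smul, smul_coe_mat, smul_sub, smul_sub, smul_smul p.im p.im, hv, smul_coe_mat,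
    Matrix.sub_mul, Matrix.smul_mul]
  simp only [sub_mul, mul_sub, smul_mul_assoc, mul_smul_comm, one_mul, mul_one, mul_assoc, hc',
    Matrix.mul_assoc, Matrix.mul_sub, Matrix.mul_smul, Matrix.sub_mul, Matrix.smul_mul, smul_sub,
    neg_smul]
  rw [smul_comm p.im p.re (C * G)]
  abel

theorem realization_eq_add_mul (p : ℍ) : realization A B C D p =
    D + starMul (fun _ => C) (starResolvent A) p * B := rfl

theorem hasSum_schurKernel (S : ℍ → Matrix (Fin n) (Fin n) ℍ) {p q : ℍ} (hp : ‖p‖ < 1)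
    (hq : ‖q‖ < 1) (η ξ : Fin n → ℍ) :
    HasSum (fun u : ℕ => reInner (star p ^ u • η) (star q ^ u • ξ) -
      reInner ((S p)ᴴ *ᵥ (star p ^ u • η)) ((S q)ᴴ *ᵥ (star q ^ u • ξ)))
      (reInner η (schurKernel S p q *ᵥ ξ)) := by
  let W : Matrix (Fin n) (Fin n) ℍ := 1 - S p * (S q)ᴴ
  let L : Matrix (Fin n) (Fin n) ℍ →ₗ[ℝ] ℝ :=
    { toFun := fun M => reInner η (M *ᵥ ξ)
      map_add' := fun M M' => by rw [Matrix.add_mulVec, map_add]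
      map_smul' := fun r M => by rw [Matrix.smul_mulVec, map_smul]; rfl }
  have hL : Continuous L := L.continuous_of_finiteDimensional
  have h1 : HasSum (fun u : ℕ => Matrix.of fun i j => p ^ u * W i j * star q ^ u)
      (schurKernel S p q) :=
    Pi.hasSum.2 fun i => Pi.hasSum.2 fun j =>
      (summable_schurKernel (W i j) (mem_ball_zero_iff.2 hp) (mem_ball_zero_iff.2 hq)).hasSum
  have h2 := h1.map L hL
  refine h2.congr_fun fun u => Eq.symm ?_
  have h3 : reInner η ((Matrix.of fun i j => p ^ u * W i j * star q ^ u) *ᵥ ξ) =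
      reInner (star p ^ u • η) (W *ᵥ (star q ^ u • ξ)) := by
    simp only [reInner_apply, dotProduct, Matrix.mulVec, Matrix.of_apply, Pi.star_apply,
      Pi.smul_apply, smul_eq_mul, star_mul, star_pow, star_star, mul_assoc, Finset.mul_sum]
  change reInner η ((Matrix.of fun i j => p ^ u * W i j * star q ^ u) *ᵥ ξ) = _
  rw [h3, Matrix.sub_mulVec, Matrix.one_mulVec, map_sub, ← Matrix.mulVec_mulVec,
    reInner_mulVec (S p)]

theorem conjTranspose_schurKernel (S : ℍ → Matrix (Fin n) (Fin n) ℍ) (p q : ℍ) :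
    (schurKernel S p q)ᴴ = schurKernel S q p := by
  refine Matrix.ext fun i j => ?_
  rw [Matrix.conjTranspose_apply, schurKernel, schurKernel, Matrix.of_apply, Matrix.of_apply,
    tsum_star]
  refine tsum_congr fun u => ?_
  have h1 : star ((1 - S p * (S q)ᴴ : Matrix (Fin n) (Fin n) ℍ) j i) =
      (1 - S q * (S p)ᴴ : Matrix (Fin n) (Fin n) ℍ) i j := by
    rw [← Matrix.conjTranspose_apply, Matrix.conjTranspose_sub, Matrix.conjTranspose_one,
      Matrix.conjTranspose_mul, Matrix.conjTranspose_conjTranspose]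
  rw [star_mul, star_mul, h1, star_pow, star_pow, star_star, mul_assoc]

/-- The dual dissipation inequality makes the kernel positive definite. Applied to the vectors
`p̄ᵘ η`, it bounds the terms of the series for the kernel from below by `F u - F (u + 1)`, where
`F ≥ 0` tends to `0`. -/
theorem isPosDefKernelOn_realization {P : Matrix (Fin N) (Fin N) ℍ}
    (hP : ∀ x, 0 ≤ reInner x (P *ᵥ x))
    (hdual : ∀ (e : Fin N → ℍ) (b : Fin n → ℍ),
      reInner e (P *ᵥ e) + reInner (Bᴴ *ᵥ e + Dᴴ *ᵥ b) (Bᴴ *ᵥ e + Dᴴ *ᵥ b) ≤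
      reInner (Aᴴ *ᵥ e + Cᴴ *ᵥ b) (P *ᵥ (Aᴴ *ᵥ e + Cᴴ *ᵥ b)) + reInner b b)
    (hunit : ∀ p : ℍ, ‖p‖ < 1 → IsUnit (charMat A p)) :
    IsPosDefKernelOn (schurKernel (realization A B C D)) (Metric.ball 0 1) := by
  set S := realization A B C D with hS
  intro r p ξ hp
  have hp' : ∀ k, ‖p k‖ < 1 := fun k => mem_ball_zero_iff.1 (hp k)
  refine ⟨Matrix.IsHermitian.ext fun k j => ?_, fun x => ?_⟩
  · rw [Matrix.of_apply, Matrix.of_apply, ← conjTranspose_schurKernel S (p k) (p j),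
      ← Matrix.star_dotProduct, Matrix.star_mulVec, ← Matrix.dotProduct_mulVec,
      Matrix.conjTranspose_conjTranspose]
  let η : Fin r → Fin n → ℍ := fun k => MulOpposite.op (x k) • ξ k
  let g : Fin r → Matrix (Fin n) (Fin N) ℍ := fun k => starMul (fun _ => C) (starResolvent A) (p k)
  let b : ℕ → Fin r → Fin n → ℍ := fun u k => star (p k) ^ u • η k
  let F : ℕ → ℝ := fun u => reInner (∑ k, (g k)ᴴ *ᵥ b u k) (P *ᵥ ∑ k, (g k)ᴴ *ᵥ b u k)
  have hquad : (star x ⬝ᵥ ((Matrix.of fun k j => star (ξ k) ⬝ᵥ (schurKernel S (p k) (p j) *ᵥ ξ j))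
      *ᵥ x)).re = ∑ k, ∑ j, reInner (η k) (schurKernel S (p k) (p j) *ᵥ η j) := by
    simp only [dotProduct, Matrix.mulVec, re_sum, Finset.mul_sum, Matrix.of_apply, reInner_apply, η,
      Pi.star_apply, Pi.smul_apply, MulOpposite.smul_eq_mul_unop, MulOpposite.unop_op, star_mul,
      Finset.sum_mul, mul_assoc]
  rw [hquad]
  have hsum : HasSum (fun u => ∑ k, ∑ j, (reInner (b u k) (b u j) -
      reInner ((S (p k))ᴴ *ᵥ b u k) ((S (p j))ᴴ *ᵥ b u j)))
      (∑ k, ∑ j, reInner (η k) (schurKernel S (p k) (p j) *ᵥ η j)) :=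
    hasSum_sum fun k _ => hasSum_sum fun j _ => hasSum_schurKernel S (hp' k) (hp' j) (η k) (η j)
  have hterm : ∀ u, F u - F (u + 1) ≤ ∑ k, ∑ j, (reInner (b u k) (b u j) -
      reInner ((S (p k))ᴴ *ᵥ b u k) ((S (p j))ᴴ *ᵥ b u j)) := fun u => by
    have h1 := hdual (∑ k, (g k)ᴴ *ᵥ b u k) (∑ k, b u k)
    have h2 : Aᴴ *ᵥ (∑ k, (g k)ᴴ *ᵥ b u k) + Cᴴ *ᵥ (∑ k, b u k) =
        ∑ k, (g k)ᴴ *ᵥ b (u + 1) k := by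
      rw [Matrix.mulVec_sum, Matrix.mulVec_sum, ← Finset.sum_add_distrib]
      refine Finset.sum_congr rfl fun k _ => ?_
      rw [Matrix.mulVec_mulVec, ← Matrix.conjTranspose_mul, ← Matrix.add_mulVec,
        ← Matrix.conjTranspose_add, ← smul_starMul_const_starResolvent (hunit _ (hp' k))]
      funext i
      simp only [Matrix.mulVec, dotProduct, Matrix.conjTranspose_apply, Matrix.smul_apply, b,
        smul_eq_mul, star_mul, Pi.smul_apply, pow_succ', mul_assoc, g]
    have h3 : Bᴴ *ᵥ (∑ k, (g k)ᴴ *ᵥ b u k) + Dᴴ *ᵥ (∑ k, b u k) =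
        ∑ k, (S (p k))ᴴ *ᵥ b u k := by
      rw [Matrix.mulVec_sum, Matrix.mulVec_sum, ← Finset.sum_add_distrib]
      refine Finset.sum_congr rfl fun k _ => ?_
      rw [Matrix.mulVec_mulVec, ← Matrix.conjTranspose_mul, ← Matrix.add_mulVec,
        ← Matrix.conjTranspose_add, add_comm, hS, realization_eq_add_mul]
    rw [h2, h3] at h1
    have h4 : ∀ y : Fin r → Fin n → ℍ,
        ∑ k, ∑ j, reInner (y k) (y j) = reInner (∑ k, y k) (∑ j, y j) := fun y => by
      simp only [map_sum, LinearMap.sum_apply]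
      exact Finset.sum_comm
    simp only [Finset.sum_sub_distrib, h4]
    change F u + _ ≤ F (u + 1) + _ at h1
    linarith
  have hF0 : Tendsto F atTop (𝓝 0) := by
    have h1 : ∀ k, Tendsto (fun u => b u k) atTop (𝓝 0) := fun k => by
      have h2 := (tendsto_pow_atTop_nhds_zero_of_norm_lt_one
        (show ‖star (p k)‖ < 1 by rw [norm_star]; exact hp' k)).smul_const (η k)
      rwa [zero_smul] at h2
    have h2 : Tendsto (fun u => ∑ k, (g k)ᴴ *ᵥ b u k) atTop (𝓝 0) := by
      have h3 := tendsto_finsetSum Finset.univ fun k _ =>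
        tendsto_mulVec (tendsto_const_nhds (x := (g k)ᴴ)) (h1 k)
      simpa only [Matrix.mulVec_zero, Finset.sum_const_zero] using h3
    have h3 := tendsto_reInner h2 (tendsto_mulVec (tendsto_const_nhds (x := P)) h2)
    simpa only [map_zero, LinearMap.zero_apply] using h3
  have hpart : ∀ m, -F m ≤ ∑ u ∈ Finset.range m, ∑ k, ∑ j, (reInner (b u k) (b u j) -
      reInner ((S (p k))ᴴ *ᵥ b u k) ((S (p j))ᴴ *ᵥ b u j)) := fun m => by
    refine le_trans ?_ (Finset.sum_le_sum fun u _ => hterm u)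
    rw [Finset.sum_range_sub']
    linarith [hP (∑ k, (g k)ᴴ *ᵥ b 0 k)]
  have h1 := le_of_tendsto_of_tendsto' hF0.neg hsum.tendsto_sum_nat hpart
  rwa [neg_zero] at h1

end Kernel

/-! ### Slice hyperholomorphy of the realization -/

section Slice

attribute [local instance] Matrix.linftyOpNormedRing Matrix.linftyOpNormedAlgebra

variable {N n : ℕ} {A : Matrix (Fin N) (Fin N) ℍ} {B : Matrix (Fin N) (Fin n) ℍ}
  {C : Matrix (Fin n) (Fin N) ℍ} {D : Matrix (Fin n) (Fin n) ℍ}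

/-- The matrix `A² - 2 x A + x² + y²`, as a function of `(x, y)`. -/
def sliceCharMat (A : Matrix (Fin N) (Fin N) ℍ) (z : ℝ × ℝ) : Matrix (Fin N) (Fin N) ℍ :=
  (z.1 • 1 - A) * (z.1 • 1 - A) + z.2 ^ 2 • 1

theorem imagUnits_mul_coe {I : ℍ} (hI : I ∈ imagUnits) (x y : ℝ) :
    ((x : ℍ) + I * (y : ℍ)).re = x ∧ ((x : ℍ) + I * (y : ℍ)).im = I * (y : ℍ) ∧
      ‖I * (y : ℍ)‖ ^ 2 = y ^ 2 := by
  have hI' : I * I = -1 := hI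
  have h1 : ‖I‖ ^ 2 = 1 := by
    have h := congrArg norm hI'
    rwa [norm_mul, norm_neg, norm_one, ← pow_two] at h
  have h0 : I.re = 0 := by
    have h2 : star I * I = 1 := by
      rw [Quaternion.star_mul_self, Quaternion.normSq_eq_norm_mul_self, ← pow_two, h1,
        Quaternion.coe_one]
    have h3 : (I + star I) * I = 0 := by rw [add_mul, h2, hI', neg_add_cancel]
    have hne : I ≠ 0 := fun h => by rw [h] at hI'; simp at hI'
    have h4 := (mul_eq_zero.1 h3).resolve_right hne
    rw [Quaternion.self_add_star', ← Quaternion.coe_zero, Quaternion.coe_inj] at h4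
    linarith
  refine ⟨by simp [Quaternion.re_mul, h0], ?_, ?_⟩
  · rw [Quaternion.mul_coe_eq_smul]
    ext <;> simp [h0]
  · rw [norm_mul, mul_pow, h1, one_mul, Quaternion.norm_coe, Real.norm_eq_abs, sq_abs]

/-- A realization is slice hyperholomorphic on the complement of the `S`-spectrum: the
Cauchy-Riemann equations hold for `(x - A) G` and `-y G`, where `G` is the inverse of
`(x - A)² + y²`. -/
theorem sliceHyperholomorphicOn_realization {Ω : Set ℍ} (hΩ : Ω ⊆ starResolventSet A) :
    SliceHyperholomorphicOn (realization A B C D) Ω := by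
  have := completeSpace_matrix N
  refine ⟨fun z => D + C * ((z.1 • 1 - A) * Ring.inverse (sliceCharMat A z)) * B,
    fun z => -(z.2 • (C * Ring.inverse (sliceCharMat A z) * B)), fun x y => ?_, fun x y => ?_,
    fun x y I hI hp => ?_⟩
  · simp only [sliceCharMat, neg_sq]
  · simp only [sliceCharMat, neg_sq, neg_smul, neg_neg]
  obtain ⟨hre, him, hnorm⟩ := imagUnits_mul_coe hI x y
  have hchar : charMat A ((x : ℍ) + I * (y : ℍ)) = sliceCharMat A (x, y) := by
    rw [charMat_eq, hre, him, hnorm, sliceCharMat]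
  have hunit : IsUnit (sliceCharMat A (x, y)) := hchar ▸ hΩ hp
  refine ⟨?_, fun i j => ?_⟩
  · rw [realization, starMul_const_starResolvent, hchar, hre, him, Matrix.sub_mul, smul_neg,
      ← smul_coe_mat y, smul_smul, Matrix.smul_mul, ← sub_eq_add_neg, ← add_sub_assoc]
  set X : ℝ × ℝ → Matrix (Fin N) (Fin N) ℍ := fun z => z.1 • 1 - A with hX
  set G : ℝ × ℝ → Matrix (Fin N) (Fin N) ℍ := fun z => Ring.inverse (sliceCharMat A z) with hG
  let L : Matrix (Fin N) (Fin N) ℍ →ₗ[ℝ] ℍ :=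
    { toFun := fun M => (C * M * B) i j
      map_add' := fun M M' => by rw [Matrix.mul_add, Matrix.add_mul, Matrix.add_apply]
      map_smul' := fun r M => by rw [Matrix.mul_smul, Matrix.smul_mul]; rfl }
  let Lc : Matrix (Fin N) (Fin N) ℍ →L[ℝ] ℍ := L.toContinuousLinearMap
  have hXd : HasFDerivAt X ((ContinuousLinearMap.fst ℝ ℝ ℝ).smulRight
      (1 : Matrix (Fin N) (Fin N) ℍ)) (x, y) :=
    ((hasFDerivAt_fst (p := ((x, y) : ℝ × ℝ))).smul_const
      (1 : Matrix (Fin N) (Fin N) ℍ)).sub_const A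
  have hPd := (hXd.mul' hXd).add (((hasFDerivAt_snd (𝕜 := ℝ)
    (p := ((x, y) : ℝ × ℝ))).pow 2).smul_const (1 : Matrix (Fin N) (Fin N) ℍ))
  obtain ⟨w, hw⟩ := hunit
  have hwinv : ((w⁻¹ : (Matrix (Fin N) (Fin N) ℍ)ˣ) : Matrix (Fin N) (Fin N) ℍ) = G (x, y) := by
    rw [hG]; simp only; rw [← hw, Ring.inverse_unit]
  have hinv := hasFDerivAt_ringInverse (𝕜 := ℝ) w
  rw [hw] at hinv
  have hGd := HasFDerivAt.comp (x, y) (f := sliceCharMat A) hinv hPd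
  have hXGd := Lc.hasFDerivAt.comp (x, y) (hXd.mul' hGd)
  have hyGd := Lc.hasFDerivAt.comp (x, y)
    ((hasFDerivAt_snd (𝕜 := ℝ) (p := ((x, y) : ℝ × ℝ))).smul hGd)
  have hα : HasFDerivAt (fun z => (D + C * (X z * G z) * B) i j) _ (x, y) := hXGd.const_add (D i j)
  have hβ' : (fun z : ℝ × ℝ => (-(z.2 • (C * G z * B))) i j) = fun z => -(Lc (z.2 • G z)) := by
    funext z
    change _ = -((C * (z.2 • G z) * B) i j)
    rw [Matrix.mul_smul, Matrix.smul_mul]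
    rfl
  have hβ := hyGd.neg.congr_of_eventuallyEq (Filter.EventuallyEq.of_eq hβ')
  have hmul : X (x, y) * X (x, y) * G (x, y) + y ^ 2 • G (x, y) = 1 := by
    have h1 := w.mul_inv
    rw [hwinv, hw, sliceCharMat, add_mul, smul_mul_assoc, one_mul] at h1
    exact h1
  have hcomm : G (x, y) * X (x, y) = X (x, y) * G (x, y) := by
    have hc : Commute (X (x, y)) (w : Matrix (Fin N) (Fin N) ℍ) := by
      rw [hw, sliceCharMat]
      exact ((Commute.refl _).mul_right (Commute.refl _)).add_right
        ((Commute.one_right _).smul_right _)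
    rw [← hwinv]
    exact (hc.units_inv_right).eq.symm
  refine ⟨hα.differentiableAt, hβ.differentiableAt, ?_, ?_⟩
  · have h1 := hα.fderiv
    have h2 := hβ.fderiv
    change fderiv ℝ (fun z => (D + C * (X z * G z) * B) i j) (x, y) (1, 0) =
      fderiv ℝ (fun z : ℝ × ℝ => (-(z.2 • (C * G z * B))) i j) (x, y) (0, 1)
    rw [h1, h2, hwinv]
    change Lc (X (x, y) * -(G (x, y) * (X (x, y) * ((1 : ℝ) • 1) + ((1 : ℝ) • 1) * X (x, y) +
        ((2 • y ^ (2 - 1)) • (0 : ℝ)) • 1) * G (x, y)) + ((1 : ℝ) • 1) * G (x, y)) =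
      -Lc (y • -(G (x, y) * (X (x, y) * ((0 : ℝ) • 1) + ((0 : ℝ) • 1) * X (x, y) +
        ((2 • y ^ (2 - 1)) • (1 : ℝ)) • 1) * G (x, y)) + (1 : ℝ) • G (x, y))
    rw [← map_neg]
    congr 1
    have h3 : X (x, y) * (G (x, y) * (X (x, y) * G (x, y))) =
        G (x, y) - y ^ 2 • (G (x, y) * G (x, y)) := by
      have h4 := congrArg (G (x, y) * ·) hmul
      simp only [mul_add, mul_one, mul_smul_comm] at h4
      refine eq_sub_iff_add_eq.2 (Eq.trans ?_ h4)
      congr 1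
      calc X (x, y) * (G (x, y) * (X (x, y) * G (x, y)))
          = (X (x, y) * G (x, y)) * (X (x, y) * G (x, y)) := by rw [mul_assoc]
        _ = (G (x, y) * X (x, y)) * (X (x, y) * G (x, y)) := by rw [hcomm]
        _ = _ := by simp only [mul_assoc]
    simp only [one_smul, zero_smul, mul_one, one_mul, mul_zero, zero_mul, add_zero,
      zero_add, mul_add, add_mul, mul_neg, smul_neg, mul_assoc, h3, smul_mul_assoc, mul_smul_comm,
      smul_smul, smul_eq_mul, nsmul_eq_mul, Nat.cast_ofNat, Nat.add_one_sub_one, pow_one]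
    rw [show y * (2 * y) = y ^ 2 + y ^ 2 by ring, add_smul]
    abel
  · have h1 := hα.fderiv
    have h2 := hβ.fderiv
    change fderiv ℝ (fun z => (D + C * (X z * G z) * B) i j) (x, y) (0, 1) =
      -fderiv ℝ (fun z : ℝ × ℝ => (-(z.2 • (C * G z * B))) i j) (x, y) (1, 0)
    rw [h1, h2, hwinv]
    change Lc (X (x, y) * -(G (x, y) * (X (x, y) * ((0 : ℝ) • 1) + ((0 : ℝ) • 1) * X (x, y) +
        ((2 • y ^ (2 - 1)) • (1 : ℝ)) • 1) * G (x, y)) + ((0 : ℝ) • 1) * G (x, y)) =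
      - -Lc (y • -(G (x, y) * (X (x, y) * ((1 : ℝ) • 1) + ((1 : ℝ) • 1) * X (x, y) +
        ((2 • y ^ (2 - 1)) • (0 : ℝ)) • 1) * G (x, y)) + (0 : ℝ) • G (x, y))
    rw [neg_neg]
    congr 1
    have h3 : G (x, y) * (X (x, y) * G (x, y)) = X (x, y) * (G (x, y) * G (x, y)) := by
      rw [← mul_assoc, hcomm, mul_assoc]
    simp only [one_smul, zero_smul, mul_one, one_mul, mul_zero, zero_mul, add_zero,
      zero_add, mul_add, add_mul, mul_neg, smul_neg, mul_assoc, h3, smul_mul_assoc, mul_smul_comm,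
      smul_eq_mul, nsmul_eq_mul, Nat.cast_ofNat, Nat.add_one_sub_one, pow_one, smul_add]
    rw [← add_smul, two_mul]

end Slice

/-! ### The two directions -/

section Realization

variable {N n : ℕ} {A : Matrix (Fin N) (Fin N) ℍ} {B : Matrix (Fin N) (Fin n) ℍ}
  {C : Matrix (Fin n) (Fin N) ℍ} {D : Matrix (Fin n) (Fin n) ℍ}

theorem isContractive_of_isNegDef {H : Matrix (Fin N) (Fin N) ℍ} (hH : IsNegDef H)
    (hpos : IsPosSemidef (Matrix.fromBlocks H 0 0 (1 : Matrix (Fin n) (Fin n) ℍ) -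
      (Matrix.fromBlocks A B C D)ᴴ * Matrix.fromBlocks H 0 0 (1 : Matrix (Fin n) (Fin n) ℍ) *
        Matrix.fromBlocks A B C D)) :
    IsContractiveInUnitBall (realization A B C D) (starResolventSet A) := by
  have hquad := (isPosSemidef_fromBlocks_iff hH.1).1 hpos
  have hneg : ∀ x, reInner x ((-H) *ᵥ x) = -reInner x (H *ᵥ x) := fun x => by
    rw [Matrix.neg_mulVec, map_neg]
  have hK : ∀ x, x ≠ 0 → 0 < reInner x ((-H) *ᵥ x) := fun x hx => by
    rw [hneg]
    exact neg_pos.2 (hH.2 x hx)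
  have hK0 : ∀ x, 0 ≤ reInner x ((-H) *ᵥ x) := fun x => by
    by_cases hx : x = 0
    · simp [hx]
    · exact (hK x hx).le
  have hdiss : ∀ x u, reInner x ((-H) *ᵥ x) + reInner (C *ᵥ x + D *ᵥ u) (C *ᵥ x + D *ᵥ u) ≤
      reInner (A *ᵥ x + B *ᵥ u) ((-H) *ᵥ (A *ᵥ x + B *ᵥ u)) + reInner u u := fun x u => by
    rw [hneg, hneg]
    linarith [hquad x u]
  have hA : ∀ x, reInner x ((-H) *ᵥ x) ≤ reInner (A *ᵥ x) ((-H) *ᵥ (A *ᵥ x)) := fun x => by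
    have h1 := hdiss x 0
    simp only [Matrix.mulVec_zero, add_zero, map_zero] at h1
    linarith [reInner_self_nonneg (C *ᵥ x)]
  have hunit : ∀ p : ℍ, ‖p‖ < 1 → IsUnit (charMat A p) := fun p hp =>
    isUnit_charMat_of_norm_lt_one hK hA hp
  have hAu : IsUnit A := isUnit_of_ker_eq_bot fun x hx => by
    by_contra hne
    have h1 := hA x
    rw [hx, Matrix.mulVec_zero, map_zero] at h1
    exact absurd (hK x hne) (not_lt.2 h1)
  have hHu : IsUnit (-H) := isUnit_of_ker_eq_bot fun x hx => by
    by_contra hne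
    have h1 := hK x hne
    rw [hx, map_zero] at h1
    exact lt_irrefl _ h1
  obtain ⟨A', hA'⟩ := hAu.exists_right_inv
  obtain ⟨P, hP⟩ := hHu.exists_right_inv
  have hP0 : ∀ x, 0 ≤ reInner x (P *ᵥ x) := fun x => by
    have h1 := hK0 (P *ᵥ x)
    rwa [Matrix.mulVec_mulVec, hP, Matrix.one_mulVec, reInner_comm] at h1
  exact ⟨realization A B C D,
    sliceHyperholomorphicOn_realization fun p hp => hunit p (mem_ball_zero_iff.1 hp),
    Set.eqOn_refl _ _,
    isPosDefKernelOn_realization hP0 (dual_dissipation hH.1.neg hK0 hP hA' hdiss) hunit⟩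

theorem Observable.eq_zero (h : Observable C A) {x : Fin N → ℍ}
    (hx : ∀ k : ℕ, (C * A ^ k) *ᵥ x = 0) : x = 0 :=
  (Set.ext_iff.1 h x).1 (Set.mem_iInter.2 hx)

theorem Controllable.eq_zero (h : Controllable A B) {x : Fin N → ℍ}
    (hx : ∀ k : ℕ, (Bᴴ * Aᴴ ^ k) *ᵥ x = 0) : x = 0 :=
  (Set.ext_iff.1 h x).1 (Set.mem_iInter.2 hx)

end Realization

end QuatSchur
end

theorem theorem4p3 (n N : ℕ)
    (A : Matrix (Fin N) (Fin N) ℍ) (B : Matrix (Fin N) (Fin n) ℍ)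
    (C : Matrix (Fin n) (Fin N) ℍ) (D : Matrix (Fin n) (Fin n) ℍ)
    (hmin : QuatSchur.Minimal C A B) :
    QuatSchur.IsContractiveInUnitBall (QuatSchur.realization A B C D)
        (QuatSchur.starResolventSet A) ↔
      ∃ H : Matrix (Fin N) (Fin N) ℍ, QuatSchur.IsNegDef H ∧
        QuatSchur.IsPosSemidef
          (Matrix.fromBlocks H 0 0 (1 : Matrix (Fin n) (Fin n) ℍ) -
            (Matrix.fromBlocks A B C D)ᴴ *
              Matrix.fromBlocks H 0 0 (1 : Matrix (Fin n) (Fin n) ℍ) *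
              Matrix.fromBlocks A B C D) :=
  ⟨QuatSchur.exists_isNegDef_of_contractive (fun _ hx => hmin.1.eq_zero hx)
      (fun _ hx => hmin.2.eq_zero hx),
    fun ⟨_, hH, hpos⟩ => QuatSchur.isContractive_of_isNegDef hH hpos⟩
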